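/- Let $\mathbb D$ be the open unit disc and $\mathbb T$ the unit circle, let $\Gamma=\{(z+w,zw): |z|\le 1,\ |w|\le 1\}$ be the closed symmetrized bidisc and $b\Gamma=\{(z+w,zw): |z|=|w|=1\}$ its distinguished boundary, and let $\Phi(z,s,p)=\dfrac{2zp-s}{2-zs}$. An inner function is a holomorphic function on $\mathbb D$, bounded by $1$ in modulus, whose radial limits have modulus $1$ almost everywhere on $\mathbb T$ (unimodular constants are allowed). For $k\ge 0$ let $\mathcal{B}l_k$ be the set of finite Blaschke products of degree at most $k$. For $\nu\ge 0$, $n\ge 1$ let $\mathcal E_{\nu n}$ be the set of rational holomorphic maps $h=(s,p):\mathbb D\to\Gamma$ for which there is $m\in\mathcal{B}l_\nu$ with $\Phi\circ(m,h)=\dfrac{2mp-s}{2-ms}\in\mathcal{B}l_{n-1}$. **Theorem.** Let $h=(s,p)$ be a holomorphic map from $\mathbb D$ to $\Gamma$. (1) If there is an inner function $m$ such that $\Phi\circ(m,h)$ is inner and $m\cdot(\Phi\circ(m,h))$ is not identically equal to $-1$, then $h$ is $\Gamma$-inner; that is, for almost every $\lambda\in\mathbb T$ the radial limit $\lim_{r\to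 1^-}h(r\lambda)$ exists and lies in $b\Gamma$. (2) If $h\in\mathcal E_{\nu n}$ for some integers $\nu\ge 0$, $n\ge 1$, and the function $m\in\mathcal{B}l_\nu$ with $\Phi\circ(m,h)\in\mathcal{B}l_{n-1}$ can be chosen so that $m\cdot(\Phi\circ(m,h))$ is not identically equal to $-1$, then $h$ is rational of degree at most $2n-2$; that is, $s$ and $p$ are rational functions of degree at most $2n-2$. -/

import Mathlib

open Filter Topology MeasureTheory

/-- The closed symmetrized bidisc `Γ`. -/
def symBidisc : Set (ℂ × ℂ) :=
  {x | ∃ z w : ℂ, ‖z‖ ≤ 1 ∧ ‖w‖ ≤ 1 ∧ x = (z + w, z * w)}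

/-- The distinguished boundary `bΓ`, the symmetrization of the 2-torus. -/
def symBidiscBoundary : Set (ℂ × ℂ) :=
  {x | ∃ z w : ℂ, ‖z‖ = 1 ∧ ‖w‖ = 1 ∧ x = (z + w, z * w)}

/-- `h ∈ Hol(𝔻, Γ)`; only the values of `h` on the open unit disc matter. -/
def IsHolSymBidisc (h : ℂ → ℂ × ℂ) : Prop :=
  DifferentiableOn ℂ h (Metric.ball 0 1) ∧ ∀ z ∈ Metric.ball (0 : ℂ) 1, h z ∈ symBidisc

/-- `f` has radial limit `l` at the boundary point `exp (i θ)`. -/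
def HasRadialLimit {E : Type*} [TopologicalSpace E] (f : ℂ → E) (θ : ℝ) (l : E) : Prop :=
  Tendsto (fun r : ℝ => f ((r : ℂ) * Complex.exp ((θ : ℂ) * Complex.I))) (𝓝[<] (1 : ℝ)) (𝓝 l)

/-- Inner functions: holomorphic and bounded by one on the disc, with radial limits of modulus one
almost everywhere. Unimodular constants are inner. (Almost every angle `θ : ℝ` is the same as
almost every point of the circle, by periodicity.) -/
def IsInner (f : ℂ → ℂ) : Prop :=
  DifferentiableOn ℂ f (Metric.ball 0 1) ∧ (∀ z ∈ Metric.ball (0 : ℂ) 1, ‖f z‖ ≤ 1) ∧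
    ∀ᵐ θ : ℝ, ∃ l : ℂ, ‖l‖ = 1 ∧ HasRadialLimit f θ l

/-- `Γ`-inner functions: elements of `Hol(𝔻, Γ)` whose radial limits exist and lie in `bΓ`
almost everywhere. -/
def IsSymBidiscInner (h : ℂ → ℂ × ℂ) : Prop :=
  IsHolSymBidisc h ∧ ∀ᵐ θ : ℝ, ∃ l ∈ symBidiscBoundary, HasRadialLimit h θ l

/-- `Φ(z, s, p) = (2 z p - s) / (2 - z s)`. -/
noncomputable def magicPhi (z : ℂ) (x : ℂ × ℂ) : ℂ :=
  (2 * z * x.2 - x.1) / (2 - z * x.1)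

/-- `Φ ∘ (m, h)`. For `m` bounded by one on the disc and `h` in `Hol(𝔻, Γ)` the denominator
`2 - m s` vanishes either nowhere on the disc or identically; in the latter case the value here is
the zero function, which is not inner. -/
noncomputable def magicPhiComp (m : ℂ → ℂ) (h : ℂ → ℂ × ℂ) : ℂ → ℂ :=
  fun z => magicPhi (m z) (h z)

/-- On the disc, `f` is a finite Blaschke product of degree at most `n`
(unimodular constants have degree zero). -/
def IsBlaschkeLE (n : ℕ) (f : ℂ → ℂ) : Prop :=
  ∃ d : ℕ, d ≤ n ∧ ∃ c : ℂ, ‖c‖ = 1 ∧ ∃ a : Fin d → ℂ, (∀ i, ‖a i‖ < 1) ∧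
    ∀ z ∈ Metric.ball (0 : ℂ) 1,
      f z = c * ∏ i, (z - a i) / (1 - (starRingEnd ℂ) (a i) * z)

/-- On the disc, `f` is the restriction of a rational function of degree `d` without poles there:
the maximum of the degrees of numerator and denominator in lowest terms is `d`. -/
def HasRationalDegree (f : ℂ → ℂ) (d : ℕ) : Prop :=
  ∃ N D : Polynomial ℂ, IsCoprime N D ∧ max N.natDegree D.natDegree = d ∧
    ∀ z ∈ Metric.ball (0 : ℂ) 1, D.eval z ≠ 0 ∧ f z = N.eval z / D.eval z

/-- The class `E_{ν k}` (for `k ≥ 1`): rational `h ∈ Hol(𝔻, Γ)` such that `Φ ∘ (m, h)` is a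
Blaschke product of degree at most `k - 1` for some Blaschke product `m` of degree at most `ν`. -/
def EClass (ν k : ℕ) : Set (ℂ → ℂ × ℂ) :=
  {h | IsHolSymBidisc h ∧
    (∃ d, HasRationalDegree (fun z => (h z).1) d) ∧
    (∃ d, HasRationalDegree (fun z => (h z).2) d) ∧
    ∃ m : ℂ → ℂ, IsBlaschkeLE ν m ∧ IsBlaschkeLE (k - 1) (magicPhiComp m h)}

/-!
Write `h = (s, p)` and `φ = Φ ∘ (m, h)`, so that `φ (2 - m s) = 2 m p - s`.

For a single point `(a + b, a b)` of `Γ` and unimodular `m`, `φ`, this relation forces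
`|a| = |b| = 1` unless `m φ = -1` (`mem_symBidiscBoundary_of_relation`). The first half of the
theorem is the passage of this fact to radial limits. It needs two results on boundary values:
Fatou's theorem, that bounded holomorphic functions have radial limits almost everywhere
(`ae_exists_hasRadialLimit`), and that the radial limit of `1 + m φ` is almost everywhere nonzero
(`ae_not_hasRadialLimit_zero`). For the former, a primitive of a bounded function is Lipschitz, hence
differentiable along the circle almost everywhere, and at a point of differentiability a kernel
dominated by the Poisson kernel recovers the radial limit of the derivative. For the latter,
`1 + m φ` has positive real part, so the logarithm of its modulus is harmonic with constant circle
means, which excludes the boundary value `0` on a set of positive measure.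

For the second half, `h` is rational and `Γ`-inner by the first, so `p` is a finite Blaschke product
(`exists_blaschke_of_norm_eval_eq`), and `s = conj s * p` on the circle gives `deg s ≤ deg p`
(`natDegree_le_of_eq_conj_mul_blaschke`). It remains to show `deg p ≤ 2 deg φ`
(`card_le_two_mul_card`). The Blaschke product `π = m² p` takes the value `1` at exactly
`2 deg m + deg p` distinct points of the circle, and
`(1 - m φ) (2 - m s) = 2 (1 - π)`, `(1 + m φ) (2 - m s) = 2 (1 - m s + π)`.
At a point with `π = 1` either `m φ = 1`, or `σ = m s` has the value `2`. In the latter case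
`|σ| ≤ 2` is maximal there, and differentiating `σ² = |σ|² π` gives `σ' = π' ≠ 0`. Hence the right
side of the second identity vanishes to second order and `2 - m s` to first order only, so
`m φ = -1` (`eq_zero_of_mul_two_sub_eq`). Since `m φ` is a Blaschke product of degree
`deg m + deg φ`, it takes each of the values `1` and `-1` at most that often, and
`2 deg m + deg p ≤ 2 (deg m + deg φ)`.
-/

/-! ### Fatou's theorem on radial limits -/

/-- Cauchy's formula for the derivative of a function that is only continuous up to the circle,
obtained by differentiating its Herglotz-Riesz representation. -/
lemma DiffContOnCl.circleAverage_mul_div_sub_sq {f : ℂ → ℂ} {w : ℂ}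
    (hf : DiffContOnCl ℂ f (Metric.ball 0 1)) (hw : w ∈ Metric.ball (0 : ℂ) 1) :
    Real.circleAverage (fun ζ => ζ / (ζ - w) ^ 2 * f ζ) 0 1 = deriv f w := by
  have hfc : ContinuousOn f (Metric.sphere 0 |1|) := by
    have := hf.continuousOn
    rw [closure_ball _ one_ne_zero] at this
    simpa using this.mono Metric.sphere_subset_closedBall
  have hfi : CircleIntegrable f 0 1 := hfc.circleIntegrable'
  have hf1 : DiffContOnCl ℂ f (Metric.ball 0 |1|) := by simpa using hf
  have hne : ∀ x ∈ Metric.ball (0 : ℂ) 1, ∀ ζ ∈ Metric.sphere (0 : ℂ) |1|, ζ - x ≠ 0 := by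
    intro x hx ζ hζ h
    rw [sub_eq_zero] at h
    subst h
    simp at hx hζ
    linarith
  have hval : ∀ x ∈ Metric.ball (0 : ℂ) 1,
      Real.circleAverage (fun ζ => herglotzRieszKernel 0 x ζ • f ζ) 0 1 = 2 * f x - f 0 := by
    intro x hx
    have h1 := hf1.circleAverage_smul_div (w := x) (by simpa using hx)
    have h2 := hf1.circleAverage
    rw [← h1, ← h2]
    have hi : CircleIntegrable (fun z => ((z - 0) / (z - x)) • f z) 0 1 := by
      apply ContinuousOn.circleIntegrable'
      exact ((continuousOn_id.sub continuousOn_const).div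
        (continuousOn_id.sub continuousOn_const) (hne x hx)).smul hfc
    have hi2 : CircleIntegrable (fun z => (2 : ℂ) • ((z - 0) / (z - x)) • f z) 0 1 :=
      hi.const_smul (a := (2 : ℂ))
    have : (2 : ℂ) * Real.circleAverage (fun z => ((z - 0) / (z - x)) • f z) 0 1
        = Real.circleAverage (fun z => (2 : ℂ) • ((z - 0) / (z - x)) • f z) 0 1 := by
      rw [Real.circleAverage_fun_smul]; simp
    rw [this, ← Real.circleAverage_fun_sub hi2 hfi]
    apply Real.circleAverage_congr_sphere
    intro z hz
    have := hne x hx z hz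
    simp only [herglotzRieszKernel, smul_eq_mul, sub_zero]
    field_simp
    ring
  have hd := hasDerivAt_circleAverage_herglotzRieszKernel_smul hfi hw
  have hd2 : HasDerivAt (fun x => 2 * f x - f 0) (2 * deriv f w) w := by
    have := (hf.differentiableAt Metric.isOpen_ball hw).hasDerivAt
    simpa using (this.const_mul 2).sub_const (f 0)
  have hd3 := hd2.congr_of_eventuallyEq
    ((Metric.isOpen_ball.mem_nhds hw |> fun h => Filter.eventually_of_mem h hval))
  have := hd.unique hd3
  have h2 : Real.circleAverage (fun ζ => (2 * ζ / (ζ - w) ^ 2) • f ζ) 0 1 =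
      2 * Real.circleAverage (fun ζ => ζ / (ζ - w) ^ 2 * f ζ) 0 1 := by
    have := Real.circleAverage_fun_smul (a := (2 : ℂ)) (f := fun ζ => ζ / (ζ - w) ^ 2 * f ζ)
      (c := (0:ℂ)) (R := 1)
    rw [smul_eq_mul] at this
    rw [← this]
    congr 1
    ext z
    simp only [smul_eq_mul]
    ring
  rw [h2] at this
  exact mul_left_cancel₀ two_ne_zero this

/-- The kernel `1 / (ζ - r)² - 1 / (1 - r ζ)²` still reproduces derivatives, because its second
half is holomorphic on the disc, and unlike the Cauchy kernel it is dominated by the Poisson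
kernel after multiplication by `1 - ζ`. -/
lemma DiffContOnCl.circleAverage_mul_sub_eq_deriv {f : ℂ → ℂ} {r : ℝ} (h0 : 0 < r) (h1 : r < 1)
    (hf : DiffContOnCl ℂ f (Metric.ball 0 1)) :
    Real.circleAverage (fun ζ => ζ * (1 / (ζ - r) ^ 2 - 1 / (1 - r * ζ) ^ 2) * f ζ) 0 1
      = deriv f r := by
  have hr : (r : ℂ) ∈ Metric.ball (0 : ℂ) 1 := by simp [abs_of_pos h0, h1]
  have hfc : ContinuousOn f (Metric.closedBall 0 1) := by
    have := hf.continuousOn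
    rwa [closure_ball _ one_ne_zero] at this
  have hfs : ContinuousOn f (Metric.sphere 0 |1|) := by
    simpa using hfc.mono Metric.sphere_subset_closedBall
  have hne : ∀ ζ ∈ Metric.closedBall (0 : ℂ) 1, (1 - r * ζ) ^ 2 ≠ 0 := by
    intro ζ hζ
    apply pow_ne_zero
    intro h
    have h2 : ‖(r : ℂ) * ζ‖ = 1 := by rw [← sub_eq_zero.mp h]; simp
    simp [abs_of_pos h0] at h2 hζ
    nlinarith
  have hne' : ∀ ζ ∈ Metric.sphere (0 : ℂ) |1|, (ζ - r) ^ 2 ≠ 0 := by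
    intro ζ hζ
    apply pow_ne_zero
    intro h
    rw [sub_eq_zero] at h
    subst h
    simp [abs_of_pos h0] at hζ
    linarith
  have hg : DiffContOnCl ℂ (fun ζ => ζ * f ζ / (1 - r * ζ) ^ 2) (Metric.ball 0 |1|) := by
    refine ⟨?_, ?_⟩
    · refine DifferentiableOn.div ?_ (by fun_prop) ?_
      · have : DifferentiableOn ℂ f (Metric.ball 0 |1|) := by simpa using hf.differentiableOn
        exact differentiableOn_id.mul this
      · intro ζ hζ
        exact hne ζ (Metric.ball_subset_closedBall (by simpa using hζ))
    · rw [abs_one, closure_ball _ one_ne_zero]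
      exact (continuousOn_id.mul hfc).div (by fun_prop) hne
  have hz := hg.circleAverage
  rw [← hf.circleAverage_mul_div_sub_sq hr]
  have hi1 : CircleIntegrable (fun ζ => ζ / (ζ - r) ^ 2 * f ζ) 0 1 := by
    apply ContinuousOn.circleIntegrable'
    exact (continuousOn_id.div (by fun_prop) hne').mul hfs
  have hi2 : CircleIntegrable (fun ζ => ζ * f ζ / (1 - r * ζ) ^ 2) 0 1 := by
    apply ContinuousOn.circleIntegrable'
    refine (continuousOn_id.mul hfs).div (by fun_prop) ?_
    intro ζ hζ
    exact hne ζ (Metric.sphere_subset_closedBall (by simpa using hζ))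
  have hs := Real.circleAverage_fun_sub hi1 hi2
  rw [hz] at hs
  simp only [zero_mul, zero_div, sub_zero] at hs
  rw [← hs]
  congr 1
  ext ζ
  ring

/-- The cubic factor cancels the singularity of the kernel at `1` altogether. -/
lemma norm_mul_sub_kernel_le {r : ℝ} (h0 : 0 < r) (h1 : r < 1) {ζ : ℂ} (hζ : ‖ζ‖ = 1) :
    ‖ζ * (1 / (ζ - r) ^ 2 - 1 / (1 - r * ζ) ^ 2)‖ * ‖ζ - 1‖
      ≤ 8 * ((1 - r ^ 2) / ‖ζ - r‖ ^ 2) ∧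
    ‖ζ * (1 / (ζ - r) ^ 2 - 1 / (1 - r * ζ) ^ 2)‖ * ‖ζ - 1‖ ^ 3 ≤ 32 * (1 - r ^ 2) := by
  have hpos : 0 < ‖ζ - r‖ := by
    rw [norm_pos_iff, sub_ne_zero]
    rintro rfl
    simp [abs_of_pos h0] at hζ
    linarith
  have heq : ‖1 - r * ζ‖ = ‖ζ - r‖ := by
    have h : ζ * (starRingEnd ℂ) ζ = 1 := by
      rw [Complex.mul_conj, Complex.normSq_eq_norm_sq, hζ]; simp
    have : 1 - r * ζ = ζ * (starRingEnd ℂ) (ζ - r) := by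
      rw [map_sub, mul_sub, h, Complex.conj_ofReal]; ring
    rw [this, norm_mul, hζ, one_mul, RCLike.norm_conj]
  have ha : ζ - r ≠ 0 := norm_pos_iff.mp hpos
  have hb : 1 - r * ζ ≠ 0 := norm_pos_iff.mp (heq ▸ hpos)
  have hK : ζ * (1 / (ζ - r) ^ 2 - 1 / (1 - r * ζ) ^ 2) =
      ζ * ((1 - r ^ 2) * (1 + ζ) * (1 - ζ)) / ((ζ - r) ^ 2 * (1 - r * ζ) ^ 2) := by
    rw [mul_sub, mul_one_div, mul_one_div, div_sub_div _ _ (pow_ne_zero 2 ha) (pow_ne_zero 2 hb)]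
    congr 1
    ring
  have hr2 : ‖(1 - (r : ℂ) ^ 2)‖ = 1 - r ^ 2 := by
    rw [← Complex.ofReal_pow, ← Complex.ofReal_one, ← Complex.ofReal_sub, Complex.norm_real,
      Real.norm_of_nonneg]
    nlinarith
  have hnK : ‖ζ * (1 / (ζ - r) ^ 2 - 1 / (1 - r * ζ) ^ 2)‖
      ≤ 2 * (1 - r ^ 2) * ‖ζ - 1‖ / ‖ζ - r‖ ^ 4 := by
    rw [hK, norm_div, norm_mul, norm_mul, norm_mul, norm_mul, norm_pow, norm_pow, heq, hζ, hr2,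
      norm_sub_rev 1 ζ, ← pow_add]
    have h2 : ‖1 + ζ‖ ≤ 2 := by
      calc ‖1 + ζ‖ ≤ ‖(1 : ℂ)‖ + ‖ζ‖ := norm_add_le _ _
        _ = 2 := by rw [hζ]; norm_num
    have hr : 0 ≤ 1 - r ^ 2 := by nlinarith
    have h3 : 1 * ((1 - r ^ 2) * ‖1 + ζ‖ * ‖ζ - 1‖) ≤ 2 * (1 - r ^ 2) * ‖ζ - 1‖ := by
      calc _ ≤ 1 * ((1 - r ^ 2) * 2 * ‖ζ - 1‖) := by gcongr
        _ = _ := by ring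
    exact div_le_div_of_nonneg_right h3 (by positivity)
  have hd : ‖ζ - 1‖ ≤ 2 * ‖ζ - r‖ := by
    have e1 : ‖ζ - 1‖ ≤ ‖ζ - r‖ + ‖(r : ℂ) - 1‖ := by
      simpa using norm_sub_le_norm_sub_add_norm_sub ζ (r : ℂ) 1
    have e2 : ‖(r : ℂ) - 1‖ = 1 - r := by
      rw [← Complex.ofReal_one, ← Complex.ofReal_sub, Complex.norm_real, Real.norm_eq_abs,
        abs_of_neg (by linarith)]
      ring
    have e3 : 1 - r ≤ ‖ζ - r‖ := by
      have := norm_sub_norm_le ζ (r : ℂ)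
      simpa [hζ, abs_of_pos h0] using this
    linarith
  have hr : 0 ≤ 1 - r ^ 2 := by nlinarith
  constructor
  · calc _ ≤ (2 * (1 - r ^ 2) * ‖ζ - 1‖ / ‖ζ - r‖ ^ 4) * ‖ζ - 1‖ := by gcongr
      _ = 2 * (1 - r ^ 2) * ‖ζ - 1‖ ^ 2 / ‖ζ - r‖ ^ 4 := by ring
      _ ≤ 2 * (1 - r ^ 2) * (2 * ‖ζ - r‖) ^ 2 / ‖ζ - r‖ ^ 4 := by gcongr
      _ = _ := by field_simp; ring
  · calc _ ≤ (2 * (1 - r ^ 2) * ‖ζ - 1‖ / ‖ζ - r‖ ^ 4) * ‖ζ - 1‖ ^ 3 := by gcongr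
      _ = 2 * (1 - r ^ 2) * ‖ζ - 1‖ ^ 4 / ‖ζ - r‖ ^ 4 := by ring
      _ ≤ 2 * (1 - r ^ 2) * (2 * ‖ζ - r‖) ^ 4 / ‖ζ - r‖ ^ 4 := by gcongr
      _ = _ := by field_simp; ring

/-- The first order term at `1` is absorbed by the Poisson kernel, of total mass one; the cubic
term controls the values away from `1`. -/
lemma norm_deriv_le_of_norm_le {f : ℂ → ℂ} {r ε C : ℝ} (h0 : 0 < r) (h1 : r < 1)
    (hf : DiffContOnCl ℂ f (Metric.ball 0 1)) (hε : 0 ≤ ε) (hC : 0 ≤ C)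
    (hb : ∀ ζ : ℂ, ‖ζ‖ = 1 → ‖f ζ‖ ≤ ε * ‖ζ - 1‖ + C * ‖ζ - 1‖ ^ 3) :
    ‖deriv f r‖ ≤ 8 * ε + 32 * C * (1 - r ^ 2) := by
  rw [← hf.circleAverage_mul_sub_eq_deriv h0 h1]
  have hr : (r : ℂ) ∈ Metric.ball (0 : ℂ) 1 := by simp [abs_of_pos h0, h1]
  have hPi : CircleIntegrable (poissonKernel 0 (r : ℂ)) 0 1 :=
    ContinuousOn.circleIntegrable' (by
      simp only [poissonKernel_eq_re_herglotzRieszKernel]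
      exact Complex.continuous_re.comp_continuousOn (continuousOn_herglotzRieszKernel_sphere hr))
  have hP : Real.circleAverage (poissonKernel 0 (r : ℂ)) 0 1 = 1 := by
    have h := (diffContOnCl_const (c := (1 : ℂ))
      (s := Metric.ball (0 : ℂ) 1) (𝕜 := ℂ)).circleAverage_poissonKernel_smul hr
    have h2 := Complex.ofRealCLM.circleAverage_comp_comm hPi
    have h3 : (poissonKernel 0 (r : ℂ) • fun _ => (1 : ℂ)) =
        Complex.ofRealCLM ∘ poissonKernel 0 (r : ℂ) := by
      ext ζ
      simp
    rw [h3, h2] at h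
    exact Complex.ofReal_injective (by simpa using h)
  have hdom : CircleIntegrable
      (fun ζ => (8 * ε) • poissonKernel 0 (r : ℂ) ζ + 32 * C * (1 - r ^ 2)) 0 1 :=
    (hPi.const_fun_smul (a := 8 * ε)).add (circleIntegrable_const _ _ _)
  have havg : Real.circleAverage
      (fun ζ => (8 * ε) • poissonKernel 0 (r : ℂ) ζ + 32 * C * (1 - r ^ 2)) 0 1 =
      8 * ε + 32 * C * (1 - r ^ 2) := by
    rw [Real.circleAverage_fun_add hPi.const_fun_smul (circleIntegrable_const _ _ _),
      Real.circleAverage_fun_smul, hP, Real.circleAverage_const]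
    simp
  rw [← havg, Real.circleAverage, Real.circleAverage, norm_smul, smul_eq_mul,
    Real.norm_of_nonneg (by positivity)]
  gcongr
  refine intervalIntegral.norm_integral_le_of_norm_le (by positivity) ?_ hdom
  refine ae_of_all _ fun θ _ => ?_
  set ζ := circleMap 0 1 θ
  have hζ : ‖ζ‖ = 1 := by simp [ζ]
  have hK := norm_mul_sub_kernel_le h0 h1 hζ
  have hPe : poissonKernel 0 (r : ℂ) ζ = (1 - r ^ 2) / ‖ζ - r‖ ^ 2 := by
    simp [poissonKernel, hζ]
  rw [norm_mul, hPe, smul_eq_mul]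
  set k := ‖ζ * (1 / (ζ - r) ^ 2 - 1 / (1 - r * ζ) ^ 2)‖
  calc k * ‖f ζ‖ ≤ k * (ε * ‖ζ - 1‖ + C * ‖ζ - 1‖ ^ 3) := by
        gcongr
        exact hb ζ hζ
    _ = ε * (k * ‖ζ - 1‖) + C * (k * ‖ζ - 1‖ ^ 3) := by ring
    _ ≤ ε * (8 * ((1 - r ^ 2) / ‖ζ - r‖ ^ 2)) + C * (32 * (1 - r ^ 2)) := by
        exact add_le_add (mul_le_mul_of_nonneg_left hK.1 hε) (mul_le_mul_of_nonneg_left hK.2 hC)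
    _ = _ := by ring

/-- If the derivative of `f` along the circle at `1` is `i A`, then `f'` has radial limit `A`
there. -/
lemma tendsto_deriv_of_hasDerivAt_circle {f : ℂ → ℂ} {A : ℂ}
    (hf : DiffContOnCl ℂ f (Metric.ball 0 1))
    (hd : HasDerivAt (fun θ : ℝ => f (Complex.exp (θ * Complex.I))) (A * Complex.I) 0) :
    Tendsto (fun r : ℝ => deriv f r) (𝓝[<] 1) (𝓝 A) := by
  set R : ℂ → ℂ := fun z => f z - (f 1 + A * (z - 1)) with hR
  have hRd : DiffContOnCl ℂ R (Metric.ball 0 1) :=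
    hf.sub (Differentiable.diffContOnCl (by fun_prop))
  have hR' : ∀ r : ℝ, 0 < r → r < 1 → deriv R r = deriv f r - A := by
    intro r h0 h1
    have hr : (r : ℂ) ∈ Metric.ball (0 : ℂ) 1 := by simp [abs_of_pos h0, h1]
    have h := (hf.differentiableAt Metric.isOpen_ball hr).hasDerivAt
    have h2 : HasDerivAt (fun z : ℂ => f 1 + A * (z - 1)) A r := by
      simpa using (((hasDerivAt_id (r : ℂ)).sub_const 1).const_mul A).const_add (f 1)
    exact (h.sub h2).deriv
  have hexp : HasDerivAt (fun θ : ℝ => Complex.exp (θ * Complex.I)) Complex.I 0 := by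
    have h := ((Complex.ofRealCLM.hasDerivAt (x := (0 : ℝ))).mul_const Complex.I).cexp
    simpa using h
  have hRθ : HasDerivAt (fun θ : ℝ => R (Complex.exp (θ * Complex.I))) 0 0 := by
    have h := hd.sub (((hexp.sub_const 1).const_mul A).const_add (f 1))
    rw [sub_self] at h
    exact h
  have hR1 : R 1 = 0 := by simp [hR]
  -- `R` is bounded on the circle
  obtain ⟨M, hM⟩ : ∃ M, ∀ ζ : ℂ, ‖ζ‖ = 1 → ‖R ζ‖ ≤ M := by
    have hc : ContinuousOn R (Metric.sphere 0 1) := by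
      have := hRd.continuousOn
      rw [closure_ball _ one_ne_zero] at this
      exact this.mono Metric.sphere_subset_closedBall
    obtain ⟨M, hM⟩ := (isCompact_sphere (0 : ℂ) 1).exists_bound_of_continuousOn hc
    exact ⟨M, fun ζ hζ => hM ζ (by simpa using hζ)⟩
  have hM0 : 0 ≤ M := (norm_nonneg _).trans (hM 1 (by simp))
  -- the bound required by the kernel estimate, for every `ε`
  have hbound : ∀ ε > 0, ∃ C ≥ 0, ∀ ζ : ℂ, ‖ζ‖ = 1 → ‖R ζ‖ ≤ ε * ‖ζ - 1‖ + C * ‖ζ - 1‖ ^ 3 := by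
    intro ε hε
    have hlo := (hasDerivAt_iff_isLittleO.mp hRθ).def (c := ε / 2) (by positivity)
    simp only [Complex.ofReal_zero, zero_mul, Complex.exp_zero, hR1, sub_zero, smul_zero] at hlo
    obtain ⟨η, hη, hlo⟩ := Metric.eventually_nhds_iff.mp hlo
    refine ⟨M * (2 / η) ^ 3, by positivity, fun ζ hζ => ?_⟩
    set t := Complex.arg ζ
    have hζt : ζ = Complex.exp (t * Complex.I) := by
      have := Complex.norm_mul_exp_arg_mul_I ζ
      rw [hζ] at this
      simpa using this.symm
    have htpi : |t| ≤ Real.pi := Complex.abs_arg_le_pi ζ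
    have hdist : |t| ≤ 2 * ‖ζ - 1‖ := by
      have h1 : ‖ζ - 1‖ = ‖2 * Real.sin (t / 2)‖ := by
        rw [← Complex.norm_exp_I_mul_ofReal_sub_one, mul_comm, ← hζt]
      have h2 := Real.mul_abs_le_abs_sin (x := t / 2) (by rw [abs_div, abs_two]; linarith)
      rw [h1, Real.norm_eq_abs, abs_mul, abs_two]
      rw [abs_div, abs_two] at h2
      have h3 : 2 / Real.pi ≥ 1 / 2 := by
        rw [ge_iff_le, div_le_div_iff₀ (by norm_num) Real.pi_pos]
        linarith [Real.pi_le_four]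
      have h4 : 1 / 2 * (|t| / 2) ≤ 2 / Real.pi * (|t| / 2) := by gcongr
      linarith
    by_cases ht : |t| < η
    · have := hlo (y := t) (by simpa using ht)
      rw [← hζt, Real.norm_eq_abs] at this
      have h5 : 0 ≤ M * (2 / η) ^ 3 * ‖ζ - 1‖ ^ 3 := by positivity
      nlinarith
    · have h5 : 1 ≤ 2 / η * ‖ζ - 1‖ := by
        rw [div_mul_eq_mul_div, le_div_iff₀ hη]
        linarith
      calc ‖R ζ‖ ≤ M * 1 := by simpa using hM ζ hζ
        _ ≤ M * (2 / η * ‖ζ - 1‖) ^ 3 := by gcongr; exact one_le_pow₀ h5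
        _ = M * (2 / η) ^ 3 * ‖ζ - 1‖ ^ 3 := by ring
        _ ≤ _ := le_add_of_nonneg_left (by positivity)
  rw [Metric.tendsto_nhds]
  intro δ hδ
  obtain ⟨C, hC, hb⟩ := hbound (δ / 16) (by positivity)
  have hlim : Tendsto (fun r : ℝ => 8 * (δ / 16) + 32 * C * (1 - r ^ 2)) (𝓝[<] 1)
      (𝓝 (δ / 2)) := by
    have : Continuous (fun r : ℝ => 8 * (δ / 16) + 32 * C * (1 - r ^ 2)) := by fun_prop
    have h := this.tendsto 1
    have e : 8 * (δ / 16) + 32 * C * (1 - (1 : ℝ) ^ 2) = δ / 2 := by ring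
    rw [e] at h
    exact h.mono_left nhdsWithin_le_nhds
  have hpos : ∀ᶠ r : ℝ in 𝓝[<] 1, 0 < r :=
    nhdsWithin_le_nhds (lt_mem_nhds one_pos)
  filter_upwards [hlim.eventually (gt_mem_nhds (show δ / 2 < δ by linarith)), hpos,
    self_mem_nhdsWithin] with r hr h0 h1
  rw [dist_eq_norm, ← hR' r h0 h1]
  exact (norm_deriv_le_of_norm_le h0 h1 hRd (by positivity) hC hb).trans_lt hr

/-- **Fatou's theorem**: a bounded holomorphic function on the disc has radial limits almost
everywhere. Its primitive extends to a Lipschitz function, which by Rademacher's theorem is almost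
everywhere differentiable along the circle. -/
theorem ae_exists_hasRadialLimit {f : ℂ → ℂ} {M : ℝ}
    (hf : DifferentiableOn ℂ f (Metric.ball 0 1)) (hM : ∀ z ∈ Metric.ball (0 : ℂ) 1, ‖f z‖ ≤ M) :
    ∀ᵐ θ : ℝ, ∃ l : ℂ, HasRadialLimit f θ l := by
  obtain ⟨F, hF⟩ := hf.isExactOn_ball
  have hM0 : 0 ≤ M := (norm_nonneg _).trans (hM 0 (by simp))
  have hlip : LipschitzOnWith M.toNNReal F (Metric.ball 0 1) := by
    refine (convex_ball (0 : ℂ) 1).lipschitzOnWith_of_nnnorm_deriv_le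
      (fun z hz => (hF z hz).differentiableAt) fun z hz => ?_
    rw [(hF z hz).deriv, ← NNReal.coe_le_coe, coe_nnnorm, Real.coe_toNNReal _ hM0]
    exact hM z hz
  obtain ⟨G, hG, hFG⟩ := hlip.extend_finite_dimension
  have hGd : ∀ z ∈ Metric.ball (0 : ℂ) 1, HasDerivAt G (f z) z := fun z hz =>
    (hF z hz).congr_of_eventuallyEq
      (eventually_of_mem (Metric.isOpen_ball.mem_nhds hz) fun x hx => (hFG hx).symm)
  have hexpL : LipschitzWith 1 (fun θ : ℝ => Complex.exp (θ * Complex.I)) := by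
    refine lipschitzWith_of_nnnorm_deriv_le (fun θ => by fun_prop) fun θ => ?_
    have h := ((Complex.ofRealCLM.hasDerivAt (x := θ)).mul_const Complex.I).cexp
    have h' : HasDerivAt (fun θ : ℝ => Complex.exp (θ * Complex.I))
      (Complex.exp (θ * Complex.I) * Complex.I) θ := by simpa using h
    rw [h'.deriv, ← NNReal.coe_le_coe]
    simp
  filter_upwards [(hG.comp hexpL).ae_differentiableAt_real] with θ hθ
  set u := Complex.exp (θ * Complex.I) with hu
  have hun : ‖u‖ = 1 := Complex.norm_exp_ofReal_mul_I θ
  have hu0 : u ≠ 0 := Complex.exp_ne_zero _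
  have hmem : ∀ z ∈ Metric.ball (0 : ℂ) 1, u * z ∈ Metric.ball (0 : ℂ) 1 := by
    intro z hz
    simpa [hun] using hz
  -- rotate to the boundary point `1`
  set g : ℂ → ℂ := fun z => u⁻¹ * G (u * z) with hg
  have hgd : ∀ z ∈ Metric.ball (0 : ℂ) 1, HasDerivAt g (f (u * z)) z := by
    intro z hz
    have h := ((hGd (u * z) (hmem z hz)).comp z ((hasDerivAt_id z).const_mul u)).const_mul u⁻¹
    have e : u⁻¹ * (f (u * z) * (u * 1)) = f (u * z) := by field_simp
    rw [e] at h
    exact h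
  have hgc : DiffContOnCl ℂ g (Metric.ball 0 1) :=
    ⟨fun z hz => (hgd z hz).differentiableAt.differentiableWithinAt,
      (continuous_const.mul (hG.continuous.comp (continuous_const.mul continuous_id))).continuousOn⟩
  have hgt : DifferentiableAt ℝ (fun t : ℝ => g (Complex.exp (t * Complex.I))) 0 := by
    have h1 : DifferentiableAt ℝ (G ∘ fun θ : ℝ => Complex.exp (θ * Complex.I)) (θ + 0) := by
      rwa [add_zero]
    have h2 := (h1.hasDerivAt.comp_const_add θ 0).differentiableAt.const_mul u⁻¹
    refine h2.congr_of_eventuallyEq (Eventually.of_forall fun t => ?_)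
    simp only [hg, hu, Function.comp, ← Complex.exp_add]
    congr 3
    push_cast
    ring
  set D := deriv (fun t : ℝ => g (Complex.exp (t * Complex.I))) 0
  have hD := hgt.hasDerivAt
  -- differentiating along the circle multiplies by `i`, whose inverse is `-i`
  refine ⟨-D * Complex.I, ?_⟩
  have hlim := tendsto_deriv_of_hasDerivAt_circle (A := -D * Complex.I) hgc (by
    have e : -D * Complex.I * Complex.I = D := by rw [mul_assoc, Complex.I_mul_I]; ring
    rw [e]
    exact hD)
  refine hlim.congr' ?_
  have hpos : ∀ᶠ r : ℝ in 𝓝[<] 1, 0 < r :=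
    nhdsWithin_le_nhds (lt_mem_nhds one_pos)
  filter_upwards [hpos, self_mem_nhdsWithin] with r h0 h1
  have hr : (r : ℂ) ∈ Metric.ball (0 : ℂ) 1 := by simpa [abs_of_pos h0] using h1
  rw [(hgd r hr).deriv, mul_comm]

/-! ### Boundary uniqueness -/

lemma Function.Periodic.ae_of_ae_Ioc {P : ℝ → Prop} {T : ℝ} (hT : 0 < T)
    (hP : ∀ θ, P (θ + T) = P θ) (h : ∀ᵐ θ ∂volume.restrict (Set.Ioc 0 T), P θ) :
    ∀ᵐ θ : ℝ, P θ := by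
  rw [ae_restrict_iff' measurableSet_Ioc] at h
  have h2 : ∀ᵐ θ : ℝ, ∀ n : ℤ, θ + n • T ∈ Set.Ioc 0 T → P (θ + n • T) := by
    rw [ae_all_iff]
    intro n
    exact (measurePreserving_add_right volume (n • T)).quasiMeasurePreserving.ae h
  filter_upwards [h2] with θ hθ
  obtain ⟨n, hn, -⟩ := existsUnique_add_zsmul_mem_Ioc hT θ 0
  rw [zero_add] at hn
  rw [← (show Function.Periodic P T from hP).zsmul n θ]
  exact hθ n hn

lemma radial_mem_ball {r : ℝ} (h0 : 0 < r) (h1 : r < 1) (θ : ℝ) :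
    (r : ℂ) * Complex.exp ((θ : ℂ) * Complex.I) ∈ Metric.ball (0 : ℂ) 1 := by
  simpa [abs_of_pos h0] using h1

lemma eventually_radial_mem_ball (θ : ℝ) :
    ∀ᶠ r : ℝ in 𝓝[<] 1, (r : ℂ) * Complex.exp ((θ : ℂ) * Complex.I) ∈ Metric.ball (0 : ℂ) 1 := by
  filter_upwards [nhdsWithin_le_nhds (lt_mem_nhds (one_pos (α := ℝ))),
    self_mem_nhdsWithin] with r h0 h1
  exact radial_mem_ball h0 h1 θ

/-- A boundary uniqueness theorem: `log ‖g‖` is harmonic, hence has constant circle means, and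
Fatou's lemma bounds the integral of its boundary values from below. -/
lemma ae_not_hasRadialLimit_zero {g : ℂ → ℂ} {B : ℝ}
    (hd : DifferentiableOn ℂ g (Metric.ball 0 1))
    (hre : ∀ z ∈ Metric.ball (0 : ℂ) 1, 0 < (g z).re)
    (hB : ∀ z ∈ Metric.ball (0 : ℂ) 1, ‖g z‖ ≤ B) :
    ∀ᵐ θ : ℝ, ¬ HasRadialLimit g θ 0 := by
  have hper : ∀ θ : ℝ, (¬ HasRadialLimit g (θ + 2 * Real.pi) 0) = ¬ HasRadialLimit g θ 0 := by
    intro θ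
    have : Complex.exp (((θ + 2 * Real.pi : ℝ) : ℂ) * Complex.I) =
        Complex.exp ((θ : ℂ) * Complex.I) := by
      rw [← Complex.exp_periodic ((θ : ℂ) * Complex.I)]
      push_cast
      ring_nf
    simp only [HasRadialLimit, this]
  refine Function.Periodic.ae_of_ae_Ioc Real.two_pi_pos hper ?_
  set u : ℂ → ℝ := fun z => Real.log B - Real.log ‖g z‖ with hu
  have hgne : ∀ z ∈ Metric.ball (0 : ℂ) 1, g z ≠ 0 := by
    intro z hz h
    have := hre z hz
    simp [h] at this
  have hucont : ContinuousOn u (Metric.ball 0 1) :=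
    continuousOn_const.sub (hd.continuousOn.norm.log fun z hz => norm_ne_zero_iff.mpr (hgne z hz))
  have hu0 : ∀ z ∈ Metric.ball (0 : ℂ) 1, 0 ≤ u z := fun z hz =>
    sub_nonneg.mpr (Real.log_le_log (norm_pos_iff.mpr (hgne z hz)) (hB z hz))
  have hsph : ∀ r : ℝ, 0 < r → r < 1 → Metric.closedBall (0 : ℂ) r ⊆ Metric.ball 0 1 :=
    fun r _ h1 => Metric.closedBall_subset_ball h1
  have hmean : ∀ r : ℝ, 0 < r → r < 1 → Real.circleAverage u 0 r = u 0 := by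
    intro r h0 h1
    have hL : DiffContOnCl ℂ (fun z => (Real.log B : ℂ) - Complex.log (g z))
        (Metric.ball 0 |r|) := by
      rw [abs_of_pos h0]
      apply DifferentiableOn.diffContOnCl
      rw [closure_ball _ h0.ne']
      exact (differentiableOn_const _).sub ((hd.mono (hsph r h0 h1)).clog
        fun z hz => Or.inl (hre z (hsph r h0 h1 hz)))
    have hLi : CircleIntegrable (fun z => (Real.log B : ℂ) - Complex.log (g z)) 0 r := by
      apply ContinuousOn.circleIntegrable'
      have := hL.continuousOn
      rw [closure_ball _ (abs_pos.mpr h0.ne').ne'] at this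
      exact this.mono Metric.sphere_subset_closedBall
    have h := congrArg Complex.re hL.circleAverage
    have h2 := Complex.reCLM.circleAverage_comp_comm hLi
    have h3 : Complex.reCLM ∘ (fun z => (Real.log B : ℂ) - Complex.log (g z)) = u := by
      ext z
      simp [hu, Complex.log_re]
    rw [h3] at h2
    rw [h2]
    simpa [hu, Complex.log_re] using h
  set ρ : ℕ → ℝ := fun n => 1 - 1 / ((n : ℝ) + 2) with hρ
  have hρ1 : ∀ n, ρ n < 1 := fun n => by
    have : (0 : ℝ) < 1 / ((n : ℝ) + 2) := by positivity
    simp only [hρ]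
    linarith
  have hρ0 : ∀ n, 0 < ρ n := fun n => by
    have : 1 / ((n : ℝ) + 2) < 1 := by
      rw [div_lt_one (by positivity)]
      have : (0 : ℝ) ≤ n := n.cast_nonneg
      linarith
    simp only [hρ]
    linarith
  have hρlim : Tendsto ρ atTop (𝓝[<] 1) := by
    refine tendsto_nhdsWithin_iff.mpr ⟨?_, Eventually.of_forall hρ1⟩
    have h : Tendsto (fun n : ℕ => 1 / ((n : ℝ) + 2)) atTop (𝓝 0) := by
      have := (tendsto_const_nhds (x := (1 : ℝ))).div_atTop
        (tendsto_atTop_add_const_right atTop (2 : ℝ) tendsto_natCast_atTop_atTop)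
      exact this
    simpa [hρ] using h.const_sub 1
  have hmem : ∀ n θ, circleMap 0 (ρ n) θ ∈ Metric.ball (0 : ℂ) 1 := by
    intro n θ
    simpa [abs_of_pos (hρ0 n)] using hρ1 n
  have hcθ : ∀ n, Continuous fun θ => u (circleMap 0 (ρ n) θ) := fun n =>
    hucont.comp_continuous (continuous_circleMap 0 (ρ n)) (hmem n)
  have hint : ∀ n, ∫⁻ θ in Set.Ioc 0 (2 * Real.pi), ENNReal.ofReal (u (circleMap 0 (ρ n) θ)) =
      ENNReal.ofReal (2 * Real.pi * u 0) := by
    intro n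
    rw [← ofReal_integral_eq_lintegral_ofReal]
    · rw [← intervalIntegral.integral_of_le Real.two_pi_pos.le, ← hmean _ (hρ0 n) (hρ1 n),
        Real.circleAverage, smul_eq_mul, mul_inv_cancel_left₀ Real.two_pi_pos.ne']
    · exact (hcθ n).integrableOn_Ioc
    · exact ae_of_all _ fun θ => hu0 _ (hmem n θ)
  have hfin : ∫⁻ θ in Set.Ioc 0 (2 * Real.pi),
      liminf (fun n => ENNReal.ofReal (u (circleMap 0 (ρ n) θ))) atTop ≠ ⊤ := by
    refine ne_top_of_le_ne_top (b := ENNReal.ofReal (2 * Real.pi * u 0)) ENNReal.ofReal_ne_top ?_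
    refine (lintegral_liminf_le fun n => (hcθ n).measurable.ennreal_ofReal).trans ?_
    simp only [hint, liminf_const, le_refl]
  have hmeas : Measurable fun θ =>
      liminf (fun n => ENNReal.ofReal (u (circleMap 0 (ρ n) θ))) atTop :=
    Measurable.liminf fun n => (hcθ n).measurable.ennreal_ofReal
  filter_upwards [ae_lt_top hmeas hfin] with θ hθ hlim
  have h1 : Tendsto (fun n => g (circleMap 0 (ρ n) θ)) atTop (𝓝 0) := by
    have := hlim.comp hρlim
    simpa [circleMap, Function.comp_def] using this
  have h2 : Tendsto (fun n => ‖g (circleMap 0 (ρ n) θ)‖) atTop (𝓝[≠] 0) := by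
    refine tendsto_nhdsWithin_iff.mpr ⟨by simpa using h1.norm, Eventually.of_forall fun n => ?_⟩
    exact norm_ne_zero_iff.mpr (hgne _ (hmem n θ))
  have h3 : Tendsto (fun n => u (circleMap 0 (ρ n) θ)) atTop atTop := by
    have h4 := tendsto_neg_atBot_atTop.comp (Real.tendsto_log_nhdsNE_zero.comp h2)
    simpa [hu, sub_eq_add_neg] using tendsto_atTop_add_const_left atTop (Real.log B) h4
  have h5 := (ENNReal.tendsto_ofReal_atTop.comp h3).liminf_eq
  simp only [Function.comp_def] at h5
  rw [h5] at hθ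
  exact lt_irrefl _ hθ

/-! ### The symmetrized bidisc and its distinguished boundary -/

/-- The two nonnegative terms measure the distance of `a` and `b` to the circle. -/
lemma norm_sq_sub_norm_sq_magicPhi (a b : ℂ) :
    ‖2 - (a + b)‖ ^ 2 - ‖2 * (a * b) - (a + b)‖ ^ 2 =
      2 * ((1 - ‖a‖ ^ 2) * ‖1 - b‖ ^ 2) + 2 * ((1 - ‖b‖ ^ 2) * ‖1 - a‖ ^ 2) := by
  simp only [← Complex.normSq_eq_norm_sq, Complex.normSq_apply, Complex.sub_re, Complex.sub_im,
    Complex.add_re, Complex.add_im, Complex.mul_re, Complex.mul_im, Complex.one_re,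
    Complex.one_im, Complex.re_ofNat, Complex.im_ofNat]
  ring

lemma norm_eq_one_of_unimodular_relation {a b ω : ℂ} (ha : ‖a‖ ≤ 1) (hb : ‖b‖ ≤ 1)
    (hω : ‖ω‖ = 1) (hne : ω ≠ -1) (h : ω * (2 - (a + b)) = 2 * (a * b) - (a + b)) :
    ‖a‖ = 1 := by
  have hn := congrArg norm h
  rw [norm_mul, hω, one_mul] at hn
  have hid := norm_sq_sub_norm_sq_magicPhi a b
  rw [hn, sub_self] at hid
  have h1 : 0 ≤ 1 - ‖a‖ ^ 2 := by nlinarith [norm_nonneg a]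
  have h2 : 0 ≤ 1 - ‖b‖ ^ 2 := by nlinarith [norm_nonneg b]
  have h3 : (1 - ‖a‖ ^ 2) * ‖1 - b‖ ^ 2 = 0 := by
    have p1 : 0 ≤ (1 - ‖a‖ ^ 2) * ‖1 - b‖ ^ 2 := by positivity
    have p2 : 0 ≤ (1 - ‖b‖ ^ 2) * ‖1 - a‖ ^ 2 := by positivity
    linarith
  rcases mul_eq_zero.mp h3 with h4 | h4
  · exact (pow_eq_one_iff_of_nonneg (norm_nonneg a) two_ne_zero).mp (by linarith)
  · have hb1 : b = 1 := by
      have : 1 - b = 0 := norm_eq_zero.mp (pow_eq_zero_iff two_ne_zero |>.mp h4)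
      linear_combination -this
    subst hb1
    have h5 : (ω + 1) * (1 - a) = 0 := by linear_combination h
    rcases mul_eq_zero.mp h5 with h6 | h6
    · exact absurd (eq_neg_of_add_eq_zero_left h6) hne
    · rw [← sub_eq_zero.mp h6]
      simp

/-- If `Φ` takes a unimodular value at a point of `Γ` for a unimodular parameter, the point lies on
the distinguished boundary, unless the value is the exceptional `-1 / μ`. -/
lemma mem_symBidiscBoundary_of_relation {x : ℂ × ℂ} (hx : x ∈ symBidisc) {μ φ : ℂ}
    (hμ : ‖μ‖ = 1) (hφ : ‖φ‖ = 1) (hne : μ * φ ≠ -1)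
    (h : φ * (2 - μ * x.1) = 2 * μ * x.2 - x.1) : x ∈ symBidiscBoundary := by
  obtain ⟨a, b, ha, hb, rfl⟩ := hx
  dsimp only at h
  have hω : ‖μ * φ‖ = 1 := by rw [norm_mul, hμ, hφ, one_mul]
  have ha' : ‖μ * a‖ = ‖a‖ := by rw [norm_mul, hμ, one_mul]
  have hb' : ‖μ * b‖ = ‖b‖ := by rw [norm_mul, hμ, one_mul]
  refine ⟨a, b, ?_, ?_, rfl⟩
  · rw [← ha']
    exact norm_eq_one_of_unimodular_relation (b := μ * b) (ha'.trans_le ha) (hb'.trans_le hb)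
      hω hne (by linear_combination μ * h)
  · rw [← hb']
    exact norm_eq_one_of_unimodular_relation (b := μ * a) (hb'.trans_le hb) (ha'.trans_le ha)
      hω hne (by linear_combination μ * h)

lemma isClosed_symBidisc : IsClosed symBidisc := by
  have : symBidisc = (fun q : ℂ × ℂ => (q.1 + q.2, q.1 * q.2)) ''
      (Metric.closedBall 0 1 ×ˢ Metric.closedBall 0 1) := by
    ext x
    simp only [symBidisc, Set.mem_ofPred_eq, Set.mem_image, Set.mem_prod, mem_closedBall_zero_iff,
      Prod.exists]
    constructor
    · rintro ⟨z, w, hz, hw, rfl⟩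
      exact ⟨z, w, ⟨hz, hw⟩, rfl⟩
    · rintro ⟨z, w, ⟨hz, hw⟩, rfl⟩
      exact ⟨z, w, hz, hw, rfl⟩
  rw [this]
  exact (((isCompact_closedBall 0 1).prod (isCompact_closedBall 0 1)).image
    (by fun_prop)).isClosed

lemma isClosed_symBidiscBoundary : IsClosed symBidiscBoundary := by
  have : symBidiscBoundary = (fun q : ℂ × ℂ => (q.1 + q.2, q.1 * q.2)) ''
      (Metric.sphere 0 1 ×ˢ Metric.sphere 0 1) := by
    ext x
    simp only [symBidiscBoundary, Set.mem_ofPred_eq, Set.mem_image, Set.mem_prod,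
      mem_sphere_zero_iff_norm, Prod.exists]
    constructor
    · rintro ⟨z, w, hz, hw, rfl⟩
      exact ⟨z, w, ⟨hz, hw⟩, rfl⟩
    · rintro ⟨z, w, ⟨hz, hw⟩, rfl⟩
      exact ⟨z, w, hz, hw, rfl⟩
  rw [this]
  exact (((isCompact_sphere 0 1).prod (isCompact_sphere 0 1)).image (by fun_prop)).isClosed

lemma norm_fst_le_of_mem_symBidisc {x : ℂ × ℂ} (hx : x ∈ symBidisc) : ‖x.1‖ ≤ 2 := by
  obtain ⟨a, b, ha, hb, rfl⟩ := hx
  exact (norm_add_le a b).trans (by linarith)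

lemma norm_snd_le_of_mem_symBidisc {x : ℂ × ℂ} (hx : x ∈ symBidisc) : ‖x.2‖ ≤ 1 := by
  obtain ⟨a, b, ha, hb, rfl⟩ := hx
  rw [norm_mul]
  exact mul_le_one₀ ha (norm_nonneg b) hb

/-- The junk value `0` of `magicPhi` at a vanishing denominator cannot occur near a boundary point
where `Φ ∘ (m, h)` has a unimodular limit. -/
lemma magicPhiComp_relation_of_tendsto {ι : Type*} {l : Filter ι} [l.NeBot] {m : ℂ → ℂ}
    {h : ℂ → ℂ × ℂ} {γ : ι → ℂ} {μ φ : ℂ} {x : ℂ × ℂ} (hm : Tendsto (fun i => m (γ i)) l (𝓝 μ))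
    (hφ : Tendsto (fun i => magicPhiComp m h (γ i)) l (𝓝 φ)) (hφ0 : φ ≠ 0)
    (hx : Tendsto (fun i => h (γ i)) l (𝓝 x)) :
    φ * (2 - μ * x.1) = 2 * μ * x.2 - x.1 := by
  have h1 := (continuous_fst.tendsto x).comp hx
  have h2 := (continuous_snd.tendsto x).comp hx
  refine tendsto_nhds_unique (hφ.mul (tendsto_const_nhds.sub (hm.mul h1)))
    ((((tendsto_const_nhds.mul hm).mul h2).sub h1).congr' ?_)
  filter_upwards [hφ.eventually_ne hφ0] with i hi
  have hden : 2 - m (γ i) * (h (γ i)).1 ≠ 0 := by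
    intro h0
    exact hi (by simp [magicPhiComp, magicPhi, h0])
  simp only [magicPhiComp, magicPhi, Function.comp]
  rw [div_mul_cancel₀ _ hden]

/-! ### Existence of an inner `Φ ∘ (m, h)` makes `h` a `Γ`-inner function -/

lemma re_one_add_pos_of_exists_ne {f : ℂ → ℂ} (hd : DifferentiableOn ℂ f (Metric.ball 0 1))
    (hb : ∀ z ∈ Metric.ball (0 : ℂ) 1, ‖f z‖ ≤ 1)
    (hne : ∃ z ∈ Metric.ball (0 : ℂ) 1, f z ≠ -1) :
    ∀ z ∈ Metric.ball (0 : ℂ) 1, 0 < (1 + f z).re := by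
  intro z hz
  by_contra! hre
  have hz1 : f z = -1 := by
    have h1 : (f z).re ≤ -1 := by
      simp only [Complex.add_re, Complex.one_re] at hre
      linarith
    have h2 : ‖f z‖ ^ 2 ≤ 1 := by
      have := hb z hz
      nlinarith [norm_nonneg (f z)]
    rw [← Complex.normSq_eq_norm_sq, Complex.normSq_apply] at h2
    have h3 : (f z).im = 0 := by nlinarith
    have h4 : (f z).re = -1 := by nlinarith
    exact Complex.ext (by simpa using h4) (by simpa using h3)
  have hmax : IsMaxOn (norm ∘ f) (Metric.ball 0 1) z := by
    intro w hw
    simpa [hz1] using hb w hw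
  have hc := Complex.eqOn_of_isPreconnected_of_isMaxOn_norm
    (convex_ball (0 : ℂ) 1).isPreconnected Metric.isOpen_ball hd hz hmax
  obtain ⟨w, hw, hwne⟩ := hne
  exact hwne ((hc hw).trans hz1)

/-- The radial limits of `h` exist by Fatou's theorem, and the relation between `m`, `Φ ∘ (m, h)`
and `h` passes to the limit. -/
theorem isSymBidiscInner_of_isInner_magicPhiComp {h : ℂ → ℂ × ℂ} (hh : IsHolSymBidisc h)
    {m : ℂ → ℂ} (hm : IsInner m) (hφ : IsInner (magicPhiComp m h))
    (hne : ∃ z ∈ Metric.ball (0 : ℂ) 1, m z * magicPhiComp m h z ≠ -1) : IsSymBidiscInner h := by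
  refine ⟨hh, ?_⟩
  obtain ⟨hmd, hmb, hmr⟩ := hm
  obtain ⟨hφd, hφb, hφr⟩ := hφ
  have hprod : ∀ z ∈ Metric.ball (0 : ℂ) 1, ‖m z * magicPhiComp m h z‖ ≤ 1 := by
    intro z hz
    rw [norm_mul]
    exact mul_le_one₀ (hmb z hz) (norm_nonneg _) (hφb z hz)
  have hpd : DifferentiableOn ℂ (fun z => m z * magicPhiComp m h z) (Metric.ball 0 1) :=
    hmd.mul hφd
  have hnz := ae_not_hasRadialLimit_zero (g := fun z => 1 + m z * magicPhiComp m h z) (B := 2)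
    ((differentiableOn_const _).add hpd) (re_one_add_pos_of_exists_ne hpd hprod hne) (by
      intro z hz
      refine (norm_add_le _ _).trans ?_
      have := hprod z hz
      rw [norm_one]
      linarith)
  have hs := ae_exists_hasRadialLimit (f := fun z => (h z).1) (M := 2) hh.1.fst
    fun z hz => norm_fst_le_of_mem_symBidisc (hh.2 z hz)
  have hp := ae_exists_hasRadialLimit (f := fun z => (h z).2) (M := 1) hh.1.snd
    fun z hz => norm_snd_le_of_mem_symBidisc (hh.2 z hz)
  filter_upwards [hmr, hφr, hnz, hs, hp] with θ ⟨μ, hμ, hmlim⟩ ⟨φ, hφ1, hφlim⟩ hne0 ⟨s, hs⟩ ⟨p, hp⟩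
  have hx : HasRadialLimit h θ (s, p) := hs.prodMk_nhds hp
  refine ⟨(s, p), ?_, hx⟩
  have hΓ : (s, p) ∈ symBidisc := isClosed_symBidisc.mem_of_tendsto hx
    ((eventually_radial_mem_ball θ).mono fun r hr => hh.2 _ hr)
  refine mem_symBidiscBoundary_of_relation hΓ hμ hφ1 ?_
    (magicPhiComp_relation_of_tendsto hmlim hφlim (norm_ne_zero_iff.mp (by simp [hφ1])) hx)
  intro h1
  apply hne0
  have := (tendsto_const_nhds (x := (1 : ℂ))).add (hmlim.mul hφlim)
  rwa [h1, add_neg_cancel] at this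

/-! ### Finite Blaschke products -/

open Polynomial in
/-- The numerator `∏ (X - a)` of the Blaschke product with zeros `s`. -/
noncomputable def blaschkeNum (s : Multiset ℂ) : ℂ[X] :=
  (s.map fun a => X - C a).prod

open Polynomial in
/-- The denominator `∏ (1 - conj a X)` of the Blaschke product with zeros `s`. -/
noncomputable def blaschkeDen (s : Multiset ℂ) : ℂ[X] :=
  (s.map fun a => 1 - C ((starRingEnd ℂ) a) * X).prod

@[simp] lemma blaschkeNum_zero : blaschkeNum 0 = 1 := by simp [blaschkeNum]

@[simp] lemma blaschkeDen_zero : blaschkeDen 0 = 1 := by simp [blaschkeDen]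

open Polynomial in
@[simp] lemma blaschkeNum_cons (a : ℂ) (s : Multiset ℂ) :
    blaschkeNum (a ::ₘ s) = (X - C a) * blaschkeNum s := by simp [blaschkeNum]

open Polynomial in
@[simp] lemma blaschkeDen_cons (a : ℂ) (s : Multiset ℂ) :
    blaschkeDen (a ::ₘ s) = (1 - C ((starRingEnd ℂ) a) * X) * blaschkeDen s := by
  simp [blaschkeDen]

lemma blaschkeNum_add (s t : Multiset ℂ) :
    blaschkeNum (s + t) = blaschkeNum s * blaschkeNum t := by simp [blaschkeNum]

lemma blaschkeDen_add (s t : Multiset ℂ) :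
    blaschkeDen (s + t) = blaschkeDen s * blaschkeDen t := by simp [blaschkeDen]

lemma natDegree_blaschkeNum (s : Multiset ℂ) : (blaschkeNum s).natDegree = s.card :=
  Polynomial.natDegree_multiset_prod_X_sub_C_eq_card s

lemma blaschkeNum_monic (s : Multiset ℂ) : (blaschkeNum s).Monic :=
  Polynomial.monic_multiset_prod_of_monic s _ fun a _ => Polynomial.monic_X_sub_C a

lemma natDegree_blaschkeDen_le (s : Multiset ℂ) : (blaschkeDen s).natDegree ≤ s.card := by
  induction s using Multiset.induction with
  | empty => simp
  | cons a s ih =>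
    rw [blaschkeDen_cons, Multiset.card_cons, add_comm s.card]
    refine Polynomial.natDegree_mul_le.trans (add_le_add ?_ ih)
    compute_degree

/-- The coefficient of degree `card s` of the denominator is `∏ (-conj a)`. -/
lemma coeff_blaschkeDen_card (s : Multiset ℂ) :
    (blaschkeDen s).coeff s.card = (s.map fun a => -(starRingEnd ℂ) a).prod := by
  induction s using Multiset.induction with
  | empty => simp
  | cons a s ih =>
    rw [blaschkeDen_cons, Multiset.card_cons, Multiset.map_cons, Multiset.prod_cons, sub_mul,
      one_mul, Polynomial.coeff_sub, mul_assoc, Polynomial.coeff_C_mul, Polynomial.coeff_X_mul, ih,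
      Polynomial.coeff_eq_zero_of_natDegree_lt
        (Nat.lt_succ_of_le (natDegree_blaschkeDen_le s))]
    ring

lemma norm_coeff_blaschkeDen_card_lt {s : Multiset ℂ} (hs : ∀ a ∈ s, ‖a‖ < 1) (h0 : s ≠ 0) :
    ‖(blaschkeDen s).coeff s.card‖ < 1 := by
  rw [coeff_blaschkeDen_card]
  have hle : ∀ t : Multiset ℂ, (∀ a ∈ t, ‖a‖ < 1) →
      ‖(t.map fun a => -(starRingEnd ℂ) a).prod‖ ≤ 1 := by
    intro t
    induction t using Multiset.induction with
    | empty => simp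
    | cons a t ih =>
      intro ht
      rw [Multiset.map_cons, Multiset.prod_cons, norm_mul, norm_neg, RCLike.norm_conj]
      exact mul_le_one₀ (ht a (Multiset.mem_cons_self a t)).le (norm_nonneg _)
        (ih fun b hb => ht b (Multiset.mem_cons_of_mem hb))
  obtain ⟨a, ha⟩ := Multiset.exists_mem_of_ne_zero h0
  obtain ⟨t, rfl⟩ := Multiset.exists_cons_of_mem ha
  rw [Multiset.map_cons, Multiset.prod_cons, norm_mul, norm_neg, RCLike.norm_conj]
  calc _ ≤ ‖a‖ * 1 := by
        gcongr
        exact hle t fun b hb => hs b (Multiset.mem_cons_of_mem hb)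
    _ < 1 := by rw [mul_one]; exact hs a ha

lemma one_sub_conj_mul_ne_zero {a z : ℂ} (ha : ‖a‖ < 1) (hz : ‖z‖ ≤ 1) :
    1 - (starRingEnd ℂ) a * z ≠ 0 := by
  intro h
  have h1 : ‖(starRingEnd ℂ) a * z‖ = 1 := by rw [← sub_eq_zero.mp h, norm_one]
  rw [norm_mul, RCLike.norm_conj] at h1
  nlinarith [norm_nonneg a, norm_nonneg z]

lemma norm_one_sub_conj_mul_sq (a z : ℂ) :
    ‖1 - (starRingEnd ℂ) a * z‖ ^ 2 - ‖z - a‖ ^ 2 = (1 - ‖a‖ ^ 2) * (1 - ‖z‖ ^ 2) := by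
  simp only [← Complex.normSq_eq_norm_sq, Complex.normSq_apply, Complex.sub_re, Complex.sub_im,
    Complex.mul_re, Complex.mul_im, Complex.one_re, Complex.one_im, Complex.conj_re,
    Complex.conj_im]
  ring

lemma one_sub_conj_mul_eq {a z : ℂ} (hz : ‖z‖ = 1) :
    1 - (starRingEnd ℂ) a * z = z * (starRingEnd ℂ) (z - a) := by
  have h : z * (starRingEnd ℂ) z = 1 := by
    rw [Complex.mul_conj, Complex.normSq_eq_norm_sq, hz]
    simp
  rw [map_sub, mul_sub, h]
  ring

lemma eval_blaschkeDen_ne_zero {s : Multiset ℂ} (hs : ∀ a ∈ s, ‖a‖ < 1) {z : ℂ} (hz : ‖z‖ ≤ 1) :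
    (blaschkeDen s).eval z ≠ 0 := by
  induction s using Multiset.induction with
  | empty => simp
  | cons a s ih =>
    rw [blaschkeDen_cons, Polynomial.eval_mul]
    refine mul_ne_zero ?_ (ih fun b hb => hs b (Multiset.mem_cons_of_mem hb))
    simpa using one_sub_conj_mul_ne_zero (hs a (Multiset.mem_cons_self a s)) hz

lemma eval_blaschkeDen_eq (s : Multiset ℂ) {z : ℂ} (hz : ‖z‖ = 1) :
    (blaschkeDen s).eval z = z ^ s.card * (starRingEnd ℂ) ((blaschkeNum s).eval z) := by
  induction s using Multiset.induction with
  | empty => simp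
  | cons a s ih =>
    rw [blaschkeDen_cons, blaschkeNum_cons, Polynomial.eval_mul, Polynomial.eval_mul, ih]
    simp only [Polynomial.eval_sub, Polynomial.eval_one, Polynomial.eval_mul, Polynomial.eval_C,
      Polynomial.eval_X, Multiset.card_cons, map_mul]
    rw [one_sub_conj_mul_eq hz]
    ring

lemma norm_eval_blaschkeNum_eq (s : Multiset ℂ) {z : ℂ} (hz : ‖z‖ = 1) :
    ‖(blaschkeNum s).eval z‖ = ‖(blaschkeDen s).eval z‖ := by
  rw [eval_blaschkeDen_eq s hz, norm_mul, norm_pow, hz, one_pow, one_mul, RCLike.norm_conj]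

lemma norm_sub_lt_of_norm_lt_one {a z : ℂ} (ha : ‖a‖ < 1) (hz : ‖z‖ < 1) :
    ‖z - a‖ < ‖1 - (starRingEnd ℂ) a * z‖ := by
  have h := norm_one_sub_conj_mul_sq a z
  have h1 : 0 < 1 - ‖a‖ ^ 2 := by nlinarith [norm_nonneg a]
  have h2 : 0 < 1 - ‖z‖ ^ 2 := by nlinarith [norm_nonneg z]
  exact lt_of_pow_lt_pow_left₀ 2 (norm_nonneg _) (by nlinarith [mul_pos h1 h2])

lemma norm_one_sub_lt_of_one_lt_norm {a z : ℂ} (ha : ‖a‖ < 1) (hz : 1 < ‖z‖) :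
    ‖1 - (starRingEnd ℂ) a * z‖ < ‖z - a‖ := by
  have h := norm_one_sub_conj_mul_sq a z
  have h1 : 0 < 1 - ‖a‖ ^ 2 := by nlinarith [norm_nonneg a]
  have h2 : 0 < ‖z‖ ^ 2 - 1 := by nlinarith
  exact lt_of_pow_lt_pow_left₀ 2 (norm_nonneg _) (by nlinarith [mul_pos h1 h2])

lemma norm_eval_blaschkeNum_lt {s : Multiset ℂ} (hs : ∀ a ∈ s, ‖a‖ < 1) (h0 : s ≠ 0) {z : ℂ}
    (hz : ‖z‖ < 1) : ‖(blaschkeNum s).eval z‖ < ‖(blaschkeDen s).eval z‖ := by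
  induction s using Multiset.induction with
  | empty => exact absurd rfl h0
  | cons a s ih =>
    have hs' : ∀ b ∈ s, ‖b‖ < 1 := fun b hb => hs b (Multiset.mem_cons_of_mem hb)
    rw [blaschkeDen_cons, blaschkeNum_cons, Polynomial.eval_mul, Polynomial.eval_mul, norm_mul,
      norm_mul]
    have h1 := norm_sub_lt_of_norm_lt_one (hs a (Multiset.mem_cons_self a s)) hz
    have h2 : ‖(blaschkeNum s).eval z‖ ≤ ‖(blaschkeDen s).eval z‖ := by
      rcases eq_or_ne s 0 with rfl | h
      · simp
      · exact (ih hs' h).le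
    have h3 := norm_pos_iff.mpr (eval_blaschkeDen_ne_zero hs' hz.le)
    simp only [Polynomial.eval_sub, Polynomial.eval_one, Polynomial.eval_mul, Polynomial.eval_C,
      Polynomial.eval_X]
    exact mul_lt_mul_of_lt_of_le_of_nonneg_of_pos h1 h2 (norm_nonneg _) h3

lemma norm_eval_blaschkeNum_gt {s : Multiset ℂ} (hs : ∀ a ∈ s, ‖a‖ < 1) (h0 : s ≠ 0) {z : ℂ}
    (hz : 1 < ‖z‖) : ‖(blaschkeDen s).eval z‖ < ‖(blaschkeNum s).eval z‖ := by
  induction s using Multiset.induction with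
  | empty => exact absurd rfl h0
  | cons a s ih =>
    have hs' : ∀ b ∈ s, ‖b‖ < 1 := fun b hb => hs b (Multiset.mem_cons_of_mem hb)
    rw [blaschkeDen_cons, blaschkeNum_cons, Polynomial.eval_mul, Polynomial.eval_mul, norm_mul,
      norm_mul]
    have h1 := norm_one_sub_lt_of_one_lt_norm (hs a (Multiset.mem_cons_self a s)) hz
    have h2 : ‖(blaschkeDen s).eval z‖ ≤ ‖(blaschkeNum s).eval z‖ ∧
        0 < ‖(blaschkeNum s).eval z‖ := by
      rcases eq_or_ne s 0 with rfl | h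
      · simp
      · exact ⟨(ih hs' h).le, (norm_nonneg _).trans_lt (ih hs' h)⟩
    simp only [Polynomial.eval_sub, Polynomial.eval_one, Polynomial.eval_mul, Polynomial.eval_C,
      Polynomial.eval_X]
    exact mul_lt_mul_of_lt_of_le_of_nonneg_of_pos h1 h2.1 (norm_nonneg _) h2.2

open Polynomial in
/-- The logarithmic derivative of a Blaschke product along the circle is a sum of Poisson
kernels, hence positive. -/
lemma exists_pos_wronskian_blaschke {s : Multiset ℂ} (hs : ∀ a ∈ s, ‖a‖ < 1) (h0 : s ≠ 0)
    {z : ℂ} (hz : ‖z‖ = 1) :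
    ∃ ρ : ℝ, 0 < ρ ∧
      z * ((derivative (blaschkeNum s)).eval z * (blaschkeDen s).eval z
        - (blaschkeNum s).eval z * (derivative (blaschkeDen s)).eval z)
      = ρ * ((blaschkeNum s).eval z * (blaschkeDen s).eval z) := by
  induction s using Multiset.induction with
  | empty => exact absurd rfl h0
  | cons a s ih =>
    have hs' : ∀ b ∈ s, ‖b‖ < 1 := fun b hb => hs b (Multiset.mem_cons_of_mem hb)
    have ha := hs a (Multiset.mem_cons_self a s)
    obtain ⟨ρ, hρ, h⟩ : ∃ ρ : ℝ, 0 ≤ ρ ∧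
        z * ((derivative (blaschkeNum s)).eval z * (blaschkeDen s).eval z
          - (blaschkeNum s).eval z * (derivative (blaschkeDen s)).eval z)
        = ρ * ((blaschkeNum s).eval z * (blaschkeDen s).eval z) := by
      rcases eq_or_ne s 0 with rfl | hne
      · exact ⟨0, le_rfl, by simp⟩
      · obtain ⟨ρ, hρ, h⟩ := ih hs' hne
        exact ⟨ρ, hρ.le, h⟩
    have hza : 0 < ‖z - a‖ := by
      rw [norm_pos_iff, sub_ne_zero]
      rintro rfl
      exact ha.ne hz
    have h1 : 0 < 1 - ‖a‖ ^ 2 := by nlinarith [norm_nonneg a]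
    refine ⟨ρ + (1 - ‖a‖ ^ 2) / ‖z - a‖ ^ 2, by positivity, ?_⟩
    have hk : z * (1 - a * (starRingEnd ℂ) a) =
        ((1 - ‖a‖ ^ 2) / ‖z - a‖ ^ 2 : ℝ) * ((z - a) * (1 - (starRingEnd ℂ) a * z)) := by
      have e1 : (z - a) * (1 - (starRingEnd ℂ) a * z) = z * ((‖z - a‖ ^ 2 : ℝ) : ℂ) := by
        rw [one_sub_conj_mul_eq hz, ← Complex.normSq_eq_norm_sq, ← Complex.mul_conj]
        ring
      have e2 : a * (starRingEnd ℂ) a = ((‖a‖ ^ 2 : ℝ) : ℂ) := by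
        rw [Complex.mul_conj, Complex.normSq_eq_norm_sq]
      have e3 : ((‖z - a‖ ^ 2 : ℝ) : ℂ) ≠ 0 := by
        exact_mod_cast (pow_pos hza 2).ne'
      rw [e1, e2, Complex.ofReal_div]
      field_simp
      push_cast
      ring
    -- the Wronskian of the product splits off the one of the new factor, computed in `hk`
    simp only [blaschkeNum_cons, blaschkeDen_cons, derivative_mul, eval_add, eval_mul, eval_sub,
      eval_one, eval_C, eval_X, derivative_sub, derivative_X, derivative_C, derivative_one,
      eval_zero]
    push_cast at hk ⊢
    linear_combination (z - a) * (1 - (starRingEnd ℂ) a * z) * h +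
      (blaschkeNum s).eval z * (blaschkeDen s).eval z * hk

open Polynomial in
/-- The points where the Blaschke product with zeros `s` and constant `c` takes the value one are
the roots of this polynomial. Its leading coefficients cannot cancel, because `∏ ‖a‖ < 1`. -/
lemma natDegree_blaschkeDen_sub {s : Multiset ℂ} (hs : ∀ a ∈ s, ‖a‖ < 1) (h0 : s ≠ 0) {c : ℂ}
    (hc : ‖c‖ = 1) : (blaschkeDen s - C c * blaschkeNum s).natDegree = s.card := by
  apply natDegree_eq_of_le_of_coeff_ne_zero
  · refine (natDegree_sub_le _ _).trans (max_le (natDegree_blaschkeDen_le s) ?_)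
    exact (natDegree_C_mul_le _ _).trans (natDegree_blaschkeNum s).le
  · have h1 : (blaschkeNum s).coeff s.card = 1 := by
      rw [← natDegree_blaschkeNum s]
      exact blaschkeNum_monic s
    rw [coeff_sub, coeff_C_mul, h1, mul_one]
    intro h
    have := norm_coeff_blaschkeDen_card_lt hs h0
    rw [sub_eq_zero.mp h, hc] at this
    exact lt_irrefl _ this

open Polynomial in
/-- A finite Blaschke product of degree `d` takes the value one at `d` distinct points of the
circle. -/
lemma exists_finset_blaschke_eq_one {s : Multiset ℂ} (hs : ∀ a ∈ s, ‖a‖ < 1) (h0 : s ≠ 0) {c : ℂ}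
    (hc : ‖c‖ = 1) :
    ∃ t : Finset ℂ, t.card = s.card ∧
      ∀ z ∈ t, ‖z‖ = 1 ∧ c * (blaschkeNum s).eval z = (blaschkeDen s).eval z := by
  set W := blaschkeDen s - C c * blaschkeNum s with hW
  have hdeg : W.natDegree = s.card := natDegree_blaschkeDen_sub hs h0 hc
  have hcard : 0 < s.card := Multiset.card_pos.mpr h0
  have hW0 : W ≠ 0 := by
    intro h
    rw [h, natDegree_zero] at hdeg
    omega
  have hroot : ∀ z, W.IsRoot z → ‖z‖ = 1 ∧ c * (blaschkeNum s).eval z = (blaschkeDen s).eval z := by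
    intro z hz
    have hz' : c * (blaschkeNum s).eval z = (blaschkeDen s).eval z := by
      have : (blaschkeDen s).eval z - c * (blaschkeNum s).eval z = 0 := by
        simpa [hW] using hz
      exact (sub_eq_zero.mp this).symm
    refine ⟨?_, hz'⟩
    have hn := congrArg norm hz'
    rw [norm_mul, hc, one_mul] at hn
    rcases lt_trichotomy ‖z‖ 1 with h | h | h
    · exact absurd hn (norm_eval_blaschkeNum_lt hs h0 h).ne
    · exact h
    · exact absurd hn (norm_eval_blaschkeNum_gt hs h0 h).ne'
  -- a double root would make the Wronskian of numerator and denominator vanish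
  have hnodup : W.roots.Nodup := by
    rw [Polynomial.nodup_roots_iff_of_splits hW0 (IsAlgClosed.splits W),
      separable_def, Polynomial.isCoprime_iff_aeval_ne_zero_of_isAlgClosed ℂ ℂ]
    intro z
    by_contra! hz
    obtain ⟨hz1, hz2⟩ := hz
    simp only [coe_aeval_eq_eval] at hz1 hz2
    obtain ⟨hzn, hzv⟩ := hroot z hz1
    obtain ⟨ρ, hρ, h⟩ := exists_pos_wronskian_blaschke hs h0 hzn
    have hd : (derivative (blaschkeDen s)).eval z = c * (derivative (blaschkeNum s)).eval z := by
      rw [hW, derivative_sub, eval_sub, derivative_C_mul, eval_C_mul] at hz2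
      exact sub_eq_zero.mp hz2
    rw [hd, ← hzv] at h
    have hD := eval_blaschkeDen_ne_zero hs hzn.le
    have hN : (blaschkeNum s).eval z ≠ 0 := by
      rw [← norm_ne_zero_iff, norm_eval_blaschkeNum_eq s hzn, norm_ne_zero_iff]
      exact hD
    have hc0 : c ≠ 0 := norm_ne_zero_iff.mp (by simp [hc])
    have hρ0 : (ρ : ℂ) ≠ 0 := by exact_mod_cast hρ.ne'
    have : (ρ : ℂ) * ((blaschkeNum s).eval z * (c * (blaschkeNum s).eval z)) = 0 := by
      rw [← h]
      ring
    exact mul_ne_zero hρ0 (mul_ne_zero hN (mul_ne_zero hc0 hN)) this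
  refine ⟨W.roots.toFinset, ?_, fun z hz => hroot z ?_⟩
  · rw [Multiset.toFinset_card_of_nodup hnodup, ← hdeg]
    exact (splits_iff_card_roots.mp (IsAlgClosed.splits W))
  · exact isRoot_of_mem_roots (Multiset.mem_toFinset.mp hz)

/-- The Blaschke product with zeros `s` and unimodular constant `c`. -/
noncomputable def blaschke (c : ℂ) (s : Multiset ℂ) (z : ℂ) : ℂ :=
  c * (blaschkeNum s).eval z / (blaschkeDen s).eval z

lemma IsBlaschkeLE.exists_blaschke {n : ℕ} {f : ℂ → ℂ} (hf : IsBlaschkeLE n f) :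
    ∃ (c : ℂ) (s : Multiset ℂ), ‖c‖ = 1 ∧ s.card ≤ n ∧ (∀ a ∈ s, ‖a‖ < 1) ∧
      ∀ z ∈ Metric.ball (0 : ℂ) 1, f z = blaschke c s z := by
  obtain ⟨d, hd, c, hc, a, ha, h⟩ := hf
  refine ⟨c, Finset.univ.val.map a, hc, by simpa using hd, by simpa using ha, fun z hz => ?_⟩
  rw [h z hz, blaschke, mul_div_assoc, Finset.prod_div_distrib, blaschkeNum, blaschkeDen,
    Polynomial.eval_multiset_prod, Polynomial.eval_multiset_prod, Multiset.map_map,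
    Multiset.map_map, Multiset.map_map, Multiset.map_map]
  simp [Function.comp_def, List.prod_ofFn]

lemma differentiableAt_blaschke {c : ℂ} {s : Multiset ℂ} (hs : ∀ a ∈ s, ‖a‖ < 1) {z : ℂ}
    (hz : ‖z‖ ≤ 1) : DifferentiableAt ℂ (blaschke c s) z := by
  unfold blaschke
  exact ((blaschkeNum s).differentiableAt.const_mul c).div (blaschkeDen s).differentiableAt
    (eval_blaschkeDen_ne_zero hs hz)

lemma norm_blaschke_eq_one {c : ℂ} (hc : ‖c‖ = 1) {s : Multiset ℂ} (hs : ∀ a ∈ s, ‖a‖ < 1) {z : ℂ}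
    (hz : ‖z‖ = 1) : ‖blaschke c s z‖ = 1 := by
  rw [blaschke, norm_div, norm_mul, hc, one_mul, norm_eval_blaschkeNum_eq s hz, div_self]
  exact norm_ne_zero_iff.mpr (eval_blaschkeDen_ne_zero hs hz.le)

lemma norm_blaschke_le_one {c : ℂ} (hc : ‖c‖ = 1) {s : Multiset ℂ} (hs : ∀ a ∈ s, ‖a‖ < 1) {z : ℂ}
    (hz : ‖z‖ < 1) : ‖blaschke c s z‖ ≤ 1 := by
  rw [blaschke, norm_div, norm_mul, hc, one_mul]
  rcases eq_or_ne s 0 with rfl | h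
  · simp
  · exact div_le_one_of_le₀ (norm_eval_blaschkeNum_lt hs h hz).le (norm_nonneg _)

lemma blaschke_mul_blaschke (c d : ℂ) (s t : Multiset ℂ) (z : ℂ) :
    blaschke c s z * blaschke d t z = blaschke (c * d) (s + t) z := by
  simp only [blaschke, blaschkeNum_add, blaschkeDen_add, Polynomial.eval_mul]
  rw [div_mul_div_comm]
  ring

/-- A function on the disc that extends continuously to a boundary point has a radial limit
there. -/
lemma hasRadialLimit_of_eqOn {E : Type*} [TopologicalSpace E] {f g : ℂ → E} {θ : ℝ}
    (hfg : Set.EqOn f g (Metric.ball 0 1))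
    (hg : ContinuousAt g (Complex.exp ((θ : ℂ) * Complex.I))) :
    HasRadialLimit f θ (g (Complex.exp ((θ : ℂ) * Complex.I))) := by
  have h1 : Tendsto (fun r : ℝ => (r : ℂ) * Complex.exp ((θ : ℂ) * Complex.I)) (𝓝[<] 1)
      (𝓝 (Complex.exp ((θ : ℂ) * Complex.I))) := by
    have : Continuous fun r : ℝ => (r : ℂ) * Complex.exp ((θ : ℂ) * Complex.I) := by fun_prop
    have h := this.tendsto 1
    rw [Complex.ofReal_one, one_mul] at h
    exact h.mono_left nhdsWithin_le_nhds
  refine (hg.tendsto.comp h1).congr' ?_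
  filter_upwards [eventually_radial_mem_ball θ] with r hr
  exact (hfg hr).symm

lemma isInner_of_eqOn_blaschke {f : ℂ → ℂ} {c : ℂ} (hc : ‖c‖ = 1) {s : Multiset ℂ}
    (hs : ∀ a ∈ s, ‖a‖ < 1) (hf : ∀ z ∈ Metric.ball (0 : ℂ) 1, f z = blaschke c s z) :
    IsInner f := by
  refine ⟨?_, fun z hz => ?_, ae_of_all _ fun θ => ⟨_, ?_, hasRadialLimit_of_eqOn hf ?_⟩⟩
  · refine DifferentiableOn.congr (fun z hz => ?_) hf
    exact (differentiableAt_blaschke hs (mem_ball_zero_iff.mp hz).le).differentiableWithinAt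
  · rw [hf z hz]
    exact norm_blaschke_le_one hc hs (by simpa using hz)
  · exact norm_blaschke_eq_one hc hs (Complex.norm_exp_ofReal_mul_I θ)
  · exact (differentiableAt_blaschke hs (Complex.norm_exp_ofReal_mul_I θ).le).continuousAt

/-! ### Rational functions with boundary symmetries -/

lemma infinite_sphere_zero_one : (Metric.sphere (0 : ℂ) 1).Infinite := by
  refine (isPreconnected_sphere ?_ 0 1).infinite_of_nontrivial ⟨1, by simp, -1, by simp, ?_⟩
  · rw [Complex.rank_real_complex]
    exact Nat.one_lt_ofNat
  · norm_num [Complex.ext_iff]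

open Polynomial in
lemma Polynomial.eq_of_forall_eval_eq_of_norm_eq_one {P Q : ℂ[X]}
    (h : ∀ z : ℂ, ‖z‖ = 1 → P.eval z = Q.eval z) : P = Q :=
  eq_of_infinite_eval_eq P Q
    (infinite_sphere_zero_one.mono fun z hz => h z (mem_sphere_zero_iff_norm.mp hz))

open Polynomial in
/-- In lowest terms, a bounded rational function on the disc has no poles on the circle. -/
lemma eval_ne_zero_of_norm_le {N D : ℂ[X]} {C : ℝ} (hco : IsCoprime N D)
    (hD : ∀ z ∈ Metric.ball (0 : ℂ) 1, D.eval z ≠ 0)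
    (hb : ∀ z ∈ Metric.ball (0 : ℂ) 1, ‖N.eval z / D.eval z‖ ≤ C) {z : ℂ} (hz : ‖z‖ ≤ 1) :
    D.eval z ≠ 0 := by
  have hle : ‖N.eval z‖ ≤ C * ‖D.eval z‖ := by
    have hcl : IsClosed {w : ℂ | ‖N.eval w‖ ≤ C * ‖D.eval w‖} :=
      isClosed_le N.continuous.norm (continuous_const.mul D.continuous.norm)
    have hsub : Metric.ball (0 : ℂ) 1 ⊆ {w : ℂ | ‖N.eval w‖ ≤ C * ‖D.eval w‖} := by
      intro w hw
      have := hb w hw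
      rwa [norm_div, div_le_iff₀ (norm_pos_iff.mpr (hD w hw))] at this
    have := hcl.closure_subset_iff.mpr hsub
    rw [closure_ball _ one_ne_zero] at this
    exact this (by simpa using hz)
  intro h0
  rw [h0, norm_zero, mul_zero] at hle
  have hN0 := norm_le_zero_iff.mp hle
  obtain ⟨u, v, huv⟩ := hco
  have := congrArg (Polynomial.eval z) huv
  simp [h0, hN0] at this

open Polynomial in
/-- A rational function without poles on the closed disc and unimodular on the circle is a finite
Blaschke product: dividing out the zeros in the disc leaves a zero-free function, constant by the
maximum principle. -/
lemma exists_blaschke_of_norm_eval_eq {A B : ℂ[X]} (hco : IsCoprime A B)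
    (hB : ∀ z : ℂ, ‖z‖ ≤ 1 → B.eval z ≠ 0)
    (hT : ∀ z : ℂ, ‖z‖ = 1 → ‖A.eval z‖ = ‖B.eval z‖) :
    ∃ (c : ℂ) (s : Multiset ℂ), ‖c‖ = 1 ∧ (∀ a ∈ s, ‖a‖ < 1) ∧
      A.natDegree ≤ s.card ∧ B.natDegree ≤ s.card ∧
      ∀ z : ℂ, ‖z‖ ≤ 1 → A.eval z / B.eval z = blaschke c s z := by
  classical
  have hA0 : A ≠ 0 := by
    rintro rfl
    have := hT 1 (by simp)
    simp only [eval_zero, norm_zero] at this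
    exact hB 1 (by simp) (norm_eq_zero.mp this.symm)
  set s := A.roots.filter (fun a => ‖a‖ < 1)
  set s' := A.roots.filter (fun a => ¬ ‖a‖ < 1)
  have hs : ∀ a ∈ s, ‖a‖ < 1 := fun a ha => (Multiset.mem_filter.mp ha).2
  set A' := C A.leadingCoeff * blaschkeNum s' with hA'
  have hfac : A = A' * blaschkeNum s := by
    have h := (IsAlgClosed.splits A).eq_prod_roots
    have h2 : A.roots = s' + s := by
      rw [add_comm]
      exact (Multiset.filter_add_not _ _).symm
    change A = C A.leadingCoeff * blaschkeNum A.roots at h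
    rw [h2, blaschkeNum_add, ← mul_assoc] at h
    exact h
  have hA'ne : ∀ z : ℂ, ‖z‖ ≤ 1 → A'.eval z ≠ 0 := by
    intro z hz h
    have hAz : A.eval z = 0 := by rw [hfac, eval_mul, h, zero_mul]
    have hz1 : ‖z‖ ≠ 1 := by
      intro h1
      have := hT z h1
      rw [hAz, norm_zero] at this
      exact hB z hz (norm_eq_zero.mp this.symm)
    rw [hA', eval_mul, eval_C, blaschkeNum, eval_multiset_prod, Multiset.map_map] at h
    rcases mul_eq_zero.mp h with h2 | h2
    · exact hA0 (leadingCoeff_eq_zero.mp h2)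
    · rw [Multiset.prod_eq_zero_iff, Multiset.mem_map] at h2
      obtain ⟨a, ha, h3⟩ := h2
      have hza : z = a := by simpa [sub_eq_zero] using h3
      exact (Multiset.mem_filter.mp ha).2 (hza ▸ lt_of_le_of_ne hz hz1)
  set g : ℂ → ℂ := fun z => A'.eval z * (blaschkeDen s).eval z / B.eval z with hg
  have hgd : ∀ z : ℂ, ‖z‖ ≤ 1 → DifferentiableAt ℂ g z := fun z hz =>
    (A'.differentiableAt.mul (blaschkeDen s).differentiableAt).div B.differentiableAt (hB z hz)
  have hg0 : ∀ z : ℂ, ‖z‖ ≤ 1 → g z ≠ 0 := fun z hz =>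
    div_ne_zero (mul_ne_zero (hA'ne z hz) (eval_blaschkeDen_ne_zero hs hz)) (hB z hz)
  have hg1 : ∀ z : ℂ, ‖z‖ = 1 → ‖g z‖ = 1 := by
    intro z hz
    simp only [hg]
    rw [norm_div, norm_mul, ← norm_eval_blaschkeNum_eq s hz, ← norm_mul, ← eval_mul, ← hfac,
      hT z hz, div_self]
    exact norm_ne_zero_iff.mpr (hB z hz.le)
  have hmax : ∀ f : ℂ → ℂ, (∀ z : ℂ, ‖z‖ ≤ 1 → DifferentiableAt ℂ f z) →
      (∀ z : ℂ, ‖z‖ = 1 → ‖f z‖ = 1) → ∀ z ∈ Metric.ball (0 : ℂ) 1, ‖f z‖ ≤ 1 := by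
    intro f hd h1 z hz
    refine Complex.norm_le_of_forall_mem_frontier_norm_le Metric.isBounded_ball ?_ ?_
      (subset_closure hz)
    · apply DifferentiableOn.diffContOnCl
      rw [closure_ball _ one_ne_zero]
      exact fun w hw => (hd w (by simpa using hw)).differentiableWithinAt
    · rw [frontier_ball _ one_ne_zero]
      exact fun w hw => (h1 w (by simpa using hw)).le
  have hgle := hmax g hgd hg1
  have hgge := hmax (fun z => (g z)⁻¹) (fun z hz => (hgd z hz).inv (hg0 z hz))
    fun z hz => by rw [norm_inv, hg1 z hz, inv_one]
  have h0mem : (0 : ℂ) ∈ Metric.ball (0 : ℂ) 1 := by simp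
  have hgn0 : ‖g 0‖ = 1 := by
    refine le_antisymm (hgle 0 h0mem) ?_
    have h1 := hgge 0 h0mem
    rw [norm_inv] at h1
    exact (inv_le_one₀ (norm_pos_iff.mpr (hg0 0 (by simp)))).mp h1
  have hconst := Complex.eqOn_of_isPreconnected_of_isMaxOn_norm
    (convex_ball (0 : ℂ) 1).isPreconnected Metric.isOpen_ball
    (fun z hz => (hgd z (mem_ball_zero_iff.mp hz).le).differentiableWithinAt) h0mem
    (fun z hz => by simpa [hgn0] using hgle z hz)
  have hpoly : A' * blaschkeDen s = C (g 0) * B := by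
    refine eq_of_infinite_eval_eq _ _
      ((infinite_of_mem_nhds 0 (Metric.ball_mem_nhds (0 : ℂ) one_pos)).mono fun z hz => ?_)
    have h1 : g z = g 0 := hconst hz
    have h2 := hB z (mem_ball_zero_iff.mp hz).le
    have h3 : g z * B.eval z = A'.eval z * (blaschkeDen s).eval z := div_mul_cancel₀ _ h2
    have h4 : (A' * blaschkeDen s).eval z = (C (g 0) * B).eval z := by
      rw [eval_mul, eval_mul (p := C (g 0)), eval_C, ← h1, h3]
    exact h4
  have hg00 : g 0 ≠ 0 := hg0 0 (by simp)
  have hunit : IsUnit A' := by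
    refine hco.isUnit_of_dvd' ⟨_, hfac⟩ ?_
    have h1 : B = C (g 0)⁻¹ * (A' * blaschkeDen s) := by
      rw [hpoly, ← mul_assoc, ← C_mul, inv_mul_cancel₀ hg00, C_1, one_mul]
    exact ⟨C (g 0)⁻¹ * blaschkeDen s, by rw [h1]; ring⟩
  have hA'deg : A'.natDegree = 0 := natDegree_eq_zero_of_isUnit hunit
  refine ⟨g 0, s, hgn0, hs, ?_, ?_, fun z hz => ?_⟩
  · rw [hfac]
    refine natDegree_mul_le.trans ?_
    rw [hA'deg, zero_add, natDegree_blaschkeNum]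
  · rw [← natDegree_C_mul hg00, ← hpoly]
    refine natDegree_mul_le.trans ?_
    rw [hA'deg, zero_add]
    exact natDegree_blaschkeDen_le s
  · obtain ⟨u, hu, hu2⟩ := isUnit_iff.mp hunit
    have hd : u * (blaschkeDen s).eval z = g 0 * B.eval z := by
      have := congrArg (eval z) hpoly
      rwa [← hu2, eval_mul, eval_mul, eval_C, eval_C] at this
    have hn : A.eval z = u * (blaschkeNum s).eval z := by
      have := congrArg (eval z) hfac
      rwa [← hu2, eval_mul, eval_C] at this
    rw [blaschke, hn, div_eq_div_iff (hB z hz) (eval_blaschkeDen_ne_zero hs hz)]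
    linear_combination (blaschkeNum s).eval z * hd

open Polynomial in
/-- The polynomial `X ^ d * conj (q (1 / conj X))`. -/
noncomputable def conjReflect (d : ℕ) (q : ℂ[X]) : ℂ[X] :=
  (q.map (starRingEnd ℂ)).reflect d

open Polynomial in
lemma eval_conjReflect {d : ℕ} {q : ℂ[X]} (hq : q.natDegree ≤ d) {z : ℂ} (hz : z ≠ 0) :
    (conjReflect d q).eval z =
      z ^ d * (starRingEnd ℂ) (q.eval (((starRingEnd ℂ) z)⁻¹)) := by
  let _ : Invertible z⁻¹ := invertibleOfNonzero (inv_ne_zero hz)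
  have h := eval₂_reflect_mul_pow (RingHom.id ℂ) z⁻¹ d (q.map (starRingEnd ℂ))
    ((natDegree_map_le).trans hq)
  rw [invOf_eq_inv, inv_inv] at h
  change (conjReflect d q).eval z * _ = (q.map (starRingEnd ℂ)).eval z⁻¹ at h
  have h2 : (q.map (starRingEnd ℂ)).eval z⁻¹ =
      (starRingEnd ℂ) (q.eval (((starRingEnd ℂ) z)⁻¹)) := by
    rw [← eval₂_hom, eval_map, map_inv₀, Complex.conj_conj]
  rw [← h2, ← h, inv_pow, mul_comm, mul_assoc, inv_mul_cancel₀ (pow_ne_zero d hz), mul_one]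

open Polynomial in
lemma eval_conjReflect_of_norm_eq_one {d : ℕ} {q : ℂ[X]} (hq : q.natDegree ≤ d) {z : ℂ}
    (hz : ‖z‖ = 1) : (conjReflect d q).eval z = z ^ d * (starRingEnd ℂ) (q.eval z) := by
  have hz0 : z ≠ 0 := norm_ne_zero_iff.mp (by simp [hz])
  rw [eval_conjReflect hq hz0]
  congr 3
  rw [inv_eq_iff_eq_inv, Complex.inv_def, Complex.normSq_eq_norm_sq, hz]
  simp

open Polynomial in
/-- A symmetry `f = conj f * b` on the circle with a finite Blaschke product `b` bounds the degree
of a rational function `f` without poles on the closed disc by the degree of `b`: by reflection,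
all poles of `f` are poles of `b`. -/
lemma natDegree_le_of_eq_conj_mul_blaschke {S E : ℂ[X]} (hco : IsCoprime S E)
    (hE : ∀ z : ℂ, ‖z‖ ≤ 1 → E.eval z ≠ 0) {c : ℂ} {s : Multiset ℂ} (hs : ∀ a ∈ s, ‖a‖ < 1)
    (hT : ∀ z : ℂ, ‖z‖ = 1 →
      S.eval z / E.eval z = (starRingEnd ℂ) (S.eval z / E.eval z) * blaschke c s z) :
    S.natDegree ≤ s.card ∧ E.natDegree ≤ s.card := by
  have hDne : blaschkeDen s ≠ 0 := fun h => by
    have := eval_blaschkeDen_ne_zero hs (z := 0) (by simp)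
    simp [h] at this
  set d := max S.natDegree E.natDegree
  have hpoly : S * conjReflect d E * blaschkeDen s = C c * conjReflect d S * E * blaschkeNum s := by
    refine eq_of_forall_eval_eq_of_norm_eq_one fun z hz => ?_
    have h1 := hT z hz
    have h2 := hE z hz.le
    have h3 := eval_blaschkeDen_ne_zero hs hz.le
    have h4 : (starRingEnd ℂ) (E.eval z) ≠ 0 := (_root_.map_ne_zero _).mpr h2
    simp only [eval_mul, eval_C]
    rw [eval_conjReflect_of_norm_eq_one (le_max_left _ _) hz,
      eval_conjReflect_of_norm_eq_one (le_max_right _ _) hz]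
    rw [blaschke, map_div₀, div_mul_div_comm, div_eq_div_iff h2 (mul_ne_zero h4 h3)] at h1
    linear_combination z ^ d * h1
  -- the roots of `E` lie outside the closed disc, those of its reflection inside
  have hEE : IsCoprime E (conjReflect d E) := by
    rw [isCoprime_iff_aeval_ne_zero_of_isAlgClosed ℂ ℂ]
    intro z
    rw [coe_aeval_eq_eval]
    by_contra! hz
    have hz1 : 1 < ‖z‖ := by
      by_contra! h
      exact hE z h hz.1
    have hz0 : z ≠ 0 := by
      rintro rfl
      norm_num at hz1
    have h := hz.2
    rw [eval_conjReflect (le_max_right _ _) hz0] at h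
    refine mul_ne_zero (pow_ne_zero d hz0) ((_root_.map_ne_zero _).mpr (hE _ ?_)) h
    rw [norm_inv, RCLike.norm_conj]
    exact inv_le_one_of_one_le₀ hz1.le
  have hdvd : E ∣ blaschkeDen s := by
    refine (hco.symm.mul_right hEE).dvd_of_dvd_mul_left ?_
    exact ⟨C c * conjReflect d S * blaschkeNum s, by rw [hpoly]; ring⟩
  obtain ⟨H, hH⟩ := hdvd
  have hH0 : H ≠ 0 := by
    rintro rfl
    exact hDne (by rw [hH, mul_zero])
  refine ⟨?_, (natDegree_le_of_dvd ⟨H, hH⟩ hDne).trans (natDegree_blaschkeDen_le s)⟩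
  rcases eq_or_ne S 0 with rfl | hS0
  · simp
  -- `f * blaschkeDen s` is the polynomial `S * H`, self-reciprocal of degree `card s`
  have hSH0 : S * H ≠ 0 := mul_ne_zero hS0 hH0
  set M := (S * H).natDegree
  have hself : X ^ M * (S * H) = C c * X ^ s.card * conjReflect M (S * H) := by
    refine eq_of_forall_eval_eq_of_norm_eq_one fun z hz => ?_
    have h1 := hT z hz
    have h2 := hE z hz.le
    have h3 := eval_blaschkeDen_ne_zero hs hz.le
    have h5 : (starRingEnd ℂ) (E.eval z) ≠ 0 := (_root_.map_ne_zero _).mpr h2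
    have h6 : (blaschkeDen s).eval z = E.eval z * H.eval z := by rw [hH, eval_mul]
    have h7 := eval_blaschkeDen_eq s hz
    have h8 : (blaschkeNum s).eval z = z ^ s.card * (starRingEnd ℂ) ((blaschkeDen s).eval z) := by
      have hzz : z * (starRingEnd ℂ) z = 1 := by
        rw [Complex.mul_conj, Complex.normSq_eq_norm_sq, hz]
        simp
      rw [h7, map_mul, map_pow, Complex.conj_conj, ← mul_assoc, ← mul_pow, hzz, one_pow, one_mul]
    simp only [eval_mul, eval_C, eval_pow, eval_X]
    rw [eval_conjReflect_of_norm_eq_one le_rfl hz, eval_mul, map_mul]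
    rw [blaschke, map_div₀, h8, h6, map_mul] at h1
    have h9 : H.eval z ≠ 0 := by
      intro h
      exact h3 (by rw [h6, h, mul_zero])
    rw [div_mul_div_comm, div_eq_div_iff h2 (mul_ne_zero h5 (mul_ne_zero h2 h9))] at h1
    have h10 : S.eval z * H.eval z =
        c * z ^ s.card * ((starRingEnd ℂ) (S.eval z) * (starRingEnd ℂ) (H.eval z)) := by
      refine mul_left_cancel₀ (mul_ne_zero h2 h5) ?_
      linear_combination h1
    rw [h10]
    ring
  have hdeg : M + M ≤ s.card + M := by
    have h1 : (X ^ M * (S * H)).natDegree = M + M := by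
      rw [natDegree_mul (pow_ne_zero M X_ne_zero) hSH0, natDegree_X_pow]
    rw [← h1, hself]
    refine natDegree_mul_le.trans (add_le_add ?_ ?_)
    · exact (natDegree_C_mul_le _ _).trans (natDegree_X_pow_le _)
    · refine (natDegree_reflect_le).trans (max_le le_rfl ?_)
      exact natDegree_map_le
  have hSM : S.natDegree ≤ M := natDegree_le_of_dvd ⟨H, rfl⟩ hSH0
  omega

/-! ### Counting boundary points -/

/-- The parametrized form of the boundary behaviour of `1 + m φ` at a point where `m s = 2`: there
`‖σ‖` is maximal, so `σ² = ‖σ‖² π` gives `σ' = π'`, and `1 - σ + π` vanishes to second order while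
`2 - σ` vanishes to first order only. -/
lemma eq_zero_of_mul_two_sub_eq {σ π q : ℝ → ℂ} {σ' π' q' : ℂ} (hσ : HasDerivAt σ σ' 0)
    (hπ : HasDerivAt π π' 0) (hq : HasDerivAt q q' 0)
    (hsq : ∀ t, σ t ^ 2 = (‖σ t‖ ^ 2 : ℝ) * π t) (hle : ∀ t, ‖σ t‖ ≤ 2) (hσ0 : σ 0 = 2)
    (hπ0 : π 0 = 1) (hrel : ∀ t, q t * (2 - σ t) = 2 * (1 - σ t + π t)) (hπ' : π' ≠ 0) :
    q 0 = 0 := by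
  have hmax : IsLocalMax (fun t => ‖σ t‖ ^ 2) 0 := by
    refine Eventually.of_forall fun t => ?_
    simp only [hσ0, Complex.norm_ofNat]
    exact pow_le_pow_left₀ (norm_nonneg _) (hle t) 2
  have hN := hσ.norm_sq
  rw [hmax.hasDerivAt_eq_zero hN] at hN
  have h1 : σ' = π' := by
    have hL := hσ.pow 2
    have hR := hN.ofReal_comp.mul hπ
    have h := hL.unique (hR.congr_of_eventuallyEq (Eventually.of_forall hsq))
    simp only [hσ0, hπ0, Complex.norm_ofNat] at h
    norm_num at h
    exact h
  have hL := hq.mul (hσ.const_sub 2)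
  have hR := ((hσ.const_sub 1).add hπ).const_mul 2
  have h := hL.unique (hR.congr_of_eventuallyEq (Eventually.of_forall hrel))
  rw [hσ0, h1] at h
  have h2 : π' * q 0 = 0 := by linear_combination -h
  exact (mul_eq_zero.mp h2).resolve_left hπ'

lemma hasDerivAt_rotate (z : ℂ) :
    HasDerivAt (fun t : ℝ => z * Complex.exp (t * Complex.I)) (z * Complex.I) 0 := by
  have h := ((Complex.ofRealCLM.hasDerivAt (x := (0 : ℝ))).mul_const Complex.I).cexp
  have h2 : HasDerivAt (fun t : ℝ => Complex.exp (t * Complex.I)) Complex.I 0 := by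
    simpa using h
  exact h2.const_mul z

lemma norm_rotate {z : ℂ} (hz : ‖z‖ = 1) (t : ℝ) : ‖z * Complex.exp (t * Complex.I)‖ = 1 := by
  rw [norm_mul, hz, Complex.norm_exp_ofReal_mul_I, one_mul]

lemma hasDerivAt_comp_rotate {f : ℂ → ℂ} {f' z : ℂ} (hf : HasDerivAt f f' z) :
    HasDerivAt (fun t : ℝ => f (z * Complex.exp (t * Complex.I))) (f' * (z * Complex.I)) 0 := by
  have h := hasDerivAt_rotate z
  have hz : z * Complex.exp ((0 : ℝ) * Complex.I) = z := by simp
  rw [← hz] at hf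
  exact hf.comp (0 : ℝ) h

/-- The argument of a nonconstant finite Blaschke product strictly increases along the circle. -/
lemma deriv_blaschke_ne_zero {c : ℂ} (hc : ‖c‖ = 1) {s : Multiset ℂ} (hs : ∀ a ∈ s, ‖a‖ < 1)
    (h0 : s ≠ 0) {z : ℂ} (hz : ‖z‖ = 1) : deriv (blaschke c s) z ≠ 0 := by
  obtain ⟨ρ, hρ, h⟩ := exists_pos_wronskian_blaschke hs h0 hz
  have hD := eval_blaschkeDen_ne_zero hs hz.le
  have hN : (blaschkeNum s).eval z ≠ 0 := by
    rw [← norm_ne_zero_iff, norm_eval_blaschkeNum_eq s hz, norm_ne_zero_iff]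
    exact hD
  have hc0 : c ≠ 0 := norm_ne_zero_iff.mp (by simp [hc])
  have hρ0 : (ρ : ℂ) ≠ 0 := by exact_mod_cast hρ.ne'
  have hd := (((blaschkeNum s).hasDerivAt z).const_mul c).div ((blaschkeDen s).hasDerivAt z) hD
  have hd' : deriv (blaschke c s) z = _ := hd.deriv
  rw [hd']
  refine div_ne_zero (fun h2 => ?_) (pow_ne_zero 2 hD)
  have h3 : c * ((ρ : ℂ) * ((blaschkeNum s).eval z * (blaschkeDen s).eval z)) = 0 := by
    rw [← h]
    linear_combination z * h2
  exact mul_ne_zero hc0 (mul_ne_zero hρ0 (mul_ne_zero hN hD)) h3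

open Polynomial in
/-- The degree of `p` is at most twice that of `Φ ∘ (m, h)`: the Blaschke product `m² p` takes the
value one at `deg (m² p)` points of the circle, and at each of them `m φ` is `1` or `-1`. -/
lemma card_le_two_mul_card {cm cφ cp : ℂ} {sm sφ sp : Multiset ℂ} {f : ℂ → ℂ}
    (hcm : ‖cm‖ = 1) (hcp : ‖cp‖ = 1) (hsm : ∀ a ∈ sm, ‖a‖ < 1)
    (hsφ : ∀ a ∈ sφ, ‖a‖ < 1) (hsp : ∀ a ∈ sp, ‖a‖ < 1)
    (hfd : ∀ z : ℂ, ‖z‖ = 1 → DifferentiableAt ℂ f z) (hf2 : ∀ z : ℂ, ‖z‖ = 1 → ‖f z‖ ≤ 2)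
    (hfsq : ∀ z : ℂ, ‖z‖ = 1 → f z ^ 2 = (‖f z‖ ^ 2 : ℝ) * blaschke cp sp z)
    (hrel : ∀ z : ℂ, ‖z‖ = 1 → blaschke cφ sφ z * (2 - blaschke cm sm z * f z) =
      2 * blaschke cm sm z * blaschke cp sp z - f z)
    (hne : ∃ z ∈ Metric.ball (0 : ℂ) 1, blaschke cm sm z * blaschke cφ sφ z ≠ -1) :
    sp.card ≤ 2 * sφ.card := by
  classical
  set c := cm * cm * cp
  set t := sm + sm + sp with ht
  have hc : ‖c‖ = 1 := by simp [c, hcm, hcp]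
  have hts : ∀ a ∈ t, ‖a‖ < 1 := by
    intro a ha
    simp only [ht, Multiset.mem_add] at ha
    rcases ha with (ha | ha) | ha
    exacts [hsm a ha, hsm a ha, hsp a ha]
  have htb : ∀ z, blaschke c t z = blaschke cm sm z ^ 2 * blaschke cp sp z := by
    intro z
    rw [pow_two, blaschke_mul_blaschke, blaschke_mul_blaschke]
  rcases eq_or_ne t 0 with h0 | h0
  · have : t.card = 0 := by rw [h0, Multiset.card_zero]
    simp only [ht, Multiset.card_add] at this
    omega
  have hus : ∀ a ∈ sm + sφ, ‖a‖ < 1 := by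
    intro a ha
    rcases Multiset.mem_add.mp ha with ha | ha
    exacts [hsm a ha, hsφ a ha]
  -- the solutions of `m φ = 1` and of `m φ = -1` are the roots of these polynomials
  set P : ℂ → ℂ[X] := fun e => blaschkeDen (sm + sφ) - C (e * (cm * cφ)) * blaschkeNum (sm + sφ)
    with hP
  have hPdeg : ∀ e, (P e).natDegree ≤ (sm + sφ).card := fun e =>
    (natDegree_sub_le _ _).trans (max_le (natDegree_blaschkeDen_le _)
      ((natDegree_C_mul_le _ _).trans (natDegree_blaschkeNum _).le))
  have hPeval : ∀ e z, ‖z‖ ≤ 1 →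
      ((P e).eval z = 0 ↔ e * (blaschke cm sm z * blaschke cφ sφ z) = 1) := by
    intro e z hz
    have hD := eval_blaschkeDen_ne_zero hus hz
    rw [blaschke_mul_blaschke, blaschke, ← mul_div_assoc, div_eq_one_iff_eq hD, hP]
    simp only [eval_sub, eval_mul, eval_C, sub_eq_zero, mul_assoc]
    exact eq_comm
  have hminus : ∀ z, ‖z‖ = 1 →
      (1 - blaschke cm sm z * blaschke cφ sφ z) * (2 - blaschke cm sm z * f z) =
        2 * (1 - blaschke c t z) := by
    intro z hz
    rw [htb]
    linear_combination -blaschke cm sm z * hrel z hz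
  have hplus : ∀ z, ‖z‖ = 1 →
      (1 + blaschke cm sm z * blaschke cφ sφ z) * (2 - blaschke cm sm z * f z) =
        2 * (1 - blaschke cm sm z * f z + blaschke c t z) := by
    intro z hz
    rw [htb]
    linear_combination blaschke cm sm z * hrel z hz
  have hP1 : P 1 ≠ 0 := by
    intro h
    have hW : blaschkeDen t - C c * blaschkeNum t = 0 := by
      refine eq_of_forall_eval_eq_of_norm_eq_one fun z hz => ?_
      have h1 := (hPeval 1 z hz.le).mp (by rw [h, eval_zero])
      have h2 := hminus z hz
      rw [one_mul] at h1
      rw [h1, sub_self, zero_mul] at h2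
      have h3 : blaschke c t z = 1 := by linear_combination h2 / 2
      rw [blaschke, div_eq_one_iff_eq (eval_blaschkeDen_ne_zero hts hz.le)] at h3
      rw [eval_sub, eval_mul, eval_C, h3, sub_self, eval_zero]
    have h1 := natDegree_blaschkeDen_sub hts h0 hc
    rw [hW, natDegree_zero] at h1
    exact h0 (Multiset.card_eq_zero.mp h1.symm)
  have hPm : P (-1) ≠ 0 := by
    intro h
    obtain ⟨z, hz, hz2⟩ := hne
    have h1 := (hPeval (-1) z (mem_ball_zero_iff.mp hz).le).mp (by rw [h, eval_zero])
    exact hz2 (by linear_combination -h1)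
  obtain ⟨T, hTcard, hT⟩ := exists_finset_blaschke_eq_one hts h0 hc
  have hsub : T ⊆ (P 1).roots.toFinset ∪ (P (-1)).roots.toFinset := by
    intro z hz
    obtain ⟨hz1, hz2⟩ := hT z hz
    have hπ : blaschke c t z = 1 := by
      rw [blaschke, div_eq_one_iff_eq (eval_blaschkeDen_ne_zero hts hz1.le)]
      exact hz2
    rw [Finset.mem_union, Multiset.mem_toFinset, Multiset.mem_toFinset, mem_roots hP1,
      mem_roots hPm, IsRoot.def, IsRoot.def, hPeval _ _ hz1.le, hPeval _ _ hz1.le]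
    have h1 := hminus z hz1
    rw [hπ, sub_self, mul_zero] at h1
    rcases mul_eq_zero.mp h1 with h2 | h2
    · exact Or.inl (by linear_combination -h2)
    · right
      have hm := differentiableAt_blaschke (c := cm) hsm hz1.le
      have hφ := differentiableAt_blaschke (c := cφ) hsφ hz1.le
      have hσd := hasDerivAt_comp_rotate (hm.mul (hfd z hz1)).hasDerivAt
      have hπd := hasDerivAt_comp_rotate (differentiableAt_blaschke (c := c) hts hz1.le).hasDerivAt
      have hqd := hasDerivAt_comp_rotate ((hm.mul hφ).const_add 1).hasDerivAt
      have hz0 : z ≠ 0 := norm_ne_zero_iff.mp (by simp [hz1])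
      have hrot : z * Complex.exp ((0 : ℝ) * Complex.I) = z := by simp
      have h3 := eq_zero_of_mul_two_sub_eq hσd hπd hqd
        (fun x => by
          have hx := norm_rotate hz1 x
          set w := z * Complex.exp (x * Complex.I)
          simp only [Pi.mul_apply]
          rw [norm_mul, norm_blaschke_eq_one hcm hsm hx, one_mul, mul_pow, hfsq w hx, htb]
          ring)
        (fun x => by
          have hx := norm_rotate hz1 x
          simp only [Pi.mul_apply]
          rw [norm_mul, norm_blaschke_eq_one hcm hsm hx, one_mul]
          exact hf2 _ hx)
        (by simp only [hrot, Pi.mul_apply]; linear_combination -h2)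
        (by rw [hrot, hπ])
        (fun x => by
          simp only [Pi.mul_apply]
          exact hplus _ (norm_rotate hz1 x))
        (mul_ne_zero (deriv_blaschke_ne_zero hc hts h0 hz1) (mul_ne_zero hz0 Complex.I_ne_zero))
      simp only [hrot, Pi.mul_apply] at h3
      linear_combination -h3
  have hcard := (Finset.card_le_card hsub).trans (Finset.card_union_le _ _)
  have hr : ∀ e, (P e).roots.toFinset.card ≤ (sm + sφ).card := fun e =>
    (Multiset.toFinset_card_le _).trans ((card_roots' _).trans (hPdeg e))
  have h1 := hr 1
  have h2 := hr (-1)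
  rw [hTcard] at hcard
  simp only [ht, Multiset.card_add] at hcard h1 h2
  omega

/-! ### Degree bound for rational maps into `Γ` -/

lemma symBidiscBoundary_relations {x : ℂ × ℂ} (hx : x ∈ symBidiscBoundary) :
    ‖x.2‖ = 1 ∧ ‖x.1‖ ≤ 2 ∧ x.1 = (starRingEnd ℂ) x.1 * x.2 := by
  obtain ⟨a, b, ha, hb, rfl⟩ := hx
  have h1 : a * (starRingEnd ℂ) a = 1 := by
    rw [Complex.mul_conj, Complex.normSq_eq_norm_sq, ha]
    simp
  have h2 : b * (starRingEnd ℂ) b = 1 := by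
    rw [Complex.mul_conj, Complex.normSq_eq_norm_sq, hb]
    simp
  refine ⟨by simp [ha, hb], (norm_add_le a b).trans (by linarith), ?_⟩
  simp only [map_add]
  linear_combination -b * h1 - a * h2

/-- By the first half of the argument `h` is `Γ`-inner, so `p` is a finite Blaschke product, whose
degree bounds that of `s` since `s = conj s * p` on the circle. -/
theorem natDegree_le_of_magicPhiComp_blaschke {h : ℂ → ℂ × ℂ} (hh : IsHolSymBidisc h)
    {ds dp ν k : ℕ} (hs : HasRationalDegree (fun z => (h z).1) ds)
    (hp : HasRationalDegree (fun z => (h z).2) dp) {m : ℂ → ℂ} (hm : IsBlaschkeLE ν m)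
    (hφ : IsBlaschkeLE k (magicPhiComp m h))
    (hne : ∃ z ∈ Metric.ball (0 : ℂ) 1, m z * magicPhiComp m h z ≠ -1) :
    ds ≤ 2 * k ∧ dp ≤ 2 * k := by
  obtain ⟨cm, sm, hcm, -, hsm, hmeq⟩ := hm.exists_blaschke
  obtain ⟨cφ, sφ, hcφ, hsφk, hsφ, hφeq⟩ := hφ.exists_blaschke
  obtain ⟨S, E, hSE, rfl, hSEeq⟩ := hs
  obtain ⟨A, B, hAB, rfl, hABeq⟩ := hp
  have hinner := isSymBidiscInner_of_isInner_magicPhiComp hh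
    (isInner_of_eqOn_blaschke hcm hsm hmeq) (isInner_of_eqOn_blaschke hcφ hsφ hφeq) hne
  have hE : ∀ z : ℂ, ‖z‖ ≤ 1 → E.eval z ≠ 0 := fun z hz =>
    eval_ne_zero_of_norm_le (C := 2) hSE (fun w hw => (hSEeq w hw).1)
      (fun w hw => (hSEeq w hw).2 ▸ norm_fst_le_of_mem_symBidisc (hh.2 w hw)) hz
  have hB : ∀ z : ℂ, ‖z‖ ≤ 1 → B.eval z ≠ 0 := fun z hz =>
    eval_ne_zero_of_norm_le (C := 1) hAB (fun w hw => (hABeq w hw).1)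
      (fun w hw => (hABeq w hw).2 ▸ norm_snd_le_of_mem_symBidisc (hh.2 w hw)) hz
  set H : ℂ → ℂ × ℂ := fun z => (S.eval z / E.eval z, A.eval z / B.eval z) with hH
  have hHeq : Set.EqOn h H (Metric.ball 0 1) := fun z hz =>
    Prod.ext (hSEeq z hz).2 (hABeq z hz).2
  have hfd : ∀ z : ℂ, ‖z‖ ≤ 1 → DifferentiableAt ℂ (fun z => S.eval z / E.eval z) z :=
    fun z hz => S.differentiableAt.div E.differentiableAt (hE z hz)
  have hHc : ∀ z : ℂ, ‖z‖ ≤ 1 → ContinuousAt H z := fun z hz =>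
    (hfd z hz).continuousAt.prodMk (A.continuousAt.div B.continuousAt (hB z hz))
  have hexp : ∀ θ : ℝ, ‖Complex.exp ((θ : ℂ) * Complex.I)‖ ≤ 1 := fun θ =>
    (Complex.norm_exp_ofReal_mul_I θ).le
  have hrad : ∀ θ : ℝ, HasRadialLimit h θ (H (Complex.exp ((θ : ℂ) * Complex.I))) := fun θ =>
    hasRadialLimit_of_eqOn hHeq (hHc _ (hexp θ))
  have hbdθ : ∀ θ : ℝ, H (Complex.exp ((θ : ℂ) * Complex.I)) ∈ symBidiscBoundary := by
    have hcont : Continuous fun θ : ℝ => H (Complex.exp ((θ : ℂ) * Complex.I)) :=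
      continuous_iff_continuousAt.mpr fun θ =>
        ContinuousAt.comp (f := fun θ : ℝ => Complex.exp ((θ : ℂ) * Complex.I))
          (hHc _ (hexp θ)) (by fun_prop)
    have hdense : Dense {θ : ℝ | H (Complex.exp ((θ : ℂ) * Complex.I)) ∈ symBidiscBoundary} := by
      refine Measure.dense_of_ae (μ := volume) ?_
      filter_upwards [hinner.2] with θ ⟨l, hl, hlim⟩
      rwa [tendsto_nhds_unique (hrad θ) hlim]
    exact fun θ => (isClosed_symBidiscBoundary.preimage hcont).closure_subset (hdense θ)
  have hpolar : ∀ z : ℂ, ‖z‖ = 1 → Complex.exp ((Complex.arg z : ℂ) * Complex.I) = z := by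
    intro z hz
    have := Complex.norm_mul_exp_arg_mul_I z
    rwa [hz, Complex.ofReal_one, one_mul] at this
  have hbd : ∀ z : ℂ, ‖z‖ = 1 → H z ∈ symBidiscBoundary := fun z hz => by
    have := hbdθ (Complex.arg z)
    rwa [hpolar z hz] at this
  obtain ⟨cp, sp, hcp, hsp, hAdeg, hBdeg, hpeq⟩ := exists_blaschke_of_norm_eval_eq hAB hB (by
    intro z hz
    have h1 := (symBidiscBoundary_relations (hbd z hz)).1
    simp only [hH, norm_div] at h1
    exact (div_eq_one_iff_eq (norm_ne_zero_iff.mpr (hB z hz.le))).mp h1)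
  have hconj : ∀ z : ℂ, ‖z‖ = 1 →
      S.eval z / E.eval z = (starRingEnd ℂ) (S.eval z / E.eval z) * blaschke cp sp z := by
    intro z hz
    have h1 := (symBidiscBoundary_relations (hbd z hz)).2.2
    simp only [hH] at h1
    rwa [hpeq z hz.le] at h1
  have hsdeg := natDegree_le_of_eq_conj_mul_blaschke hSE hE hsp hconj
  have hrel : ∀ z : ℂ, ‖z‖ = 1 →
      blaschke cφ sφ z * (2 - blaschke cm sm z * (S.eval z / E.eval z)) =
        2 * blaschke cm sm z * blaschke cp sp z - S.eval z / E.eval z := by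
    intro z hz
    have h1 : HasRadialLimit m (Complex.arg z) (blaschke cm sm z) := by
      have := hasRadialLimit_of_eqOn (θ := Complex.arg z) hmeq
        (differentiableAt_blaschke hsm (hexp _)).continuousAt
      rwa [hpolar z hz] at this
    have h2 : HasRadialLimit (magicPhiComp m h) (Complex.arg z) (blaschke cφ sφ z) := by
      have := hasRadialLimit_of_eqOn (θ := Complex.arg z) hφeq
        (differentiableAt_blaschke hsφ (hexp _)).continuousAt
      rwa [hpolar z hz] at this
    have h3 := hrad (Complex.arg z)
    rw [hpolar z hz] at h3
    have h4 := magicPhiComp_relation_of_tendsto h1 h2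
      (norm_ne_zero_iff.mp (by simp [norm_blaschke_eq_one hcφ hsφ hz])) h3
    rw [← hpeq z hz.le]
    exact h4
  have hcard : sp.card ≤ 2 * sφ.card := by
    refine card_le_two_mul_card hcm hcp hsm hsφ hsp (fun z hz => hfd z hz.le)
      (fun z hz => (symBidiscBoundary_relations (hbd z hz)).2.1) (fun z hz => ?_) hrel ?_
    · have h1 : ((‖S.eval z / E.eval z‖ ^ 2 : ℝ) : ℂ) =
          S.eval z / E.eval z * (starRingEnd ℂ) (S.eval z / E.eval z) := by
        rw [Complex.mul_conj, Complex.normSq_eq_norm_sq]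
      rw [h1]
      linear_combination S.eval z / E.eval z * hconj z hz
    · obtain ⟨z, hz, hz2⟩ := hne
      exact ⟨z, hz, by rwa [← hmeq z hz, ← hφeq z hz]⟩
  refine ⟨(max_le hsdeg.1 hsdeg.2).trans ?_, (max_le hAdeg hBdeg).trans ?_⟩ <;> omega

theorem theorem1 (h : ℂ → ℂ × ℂ) (hh : IsHolSymBidisc h) :
    ((∃ m : ℂ → ℂ, IsInner m ∧ IsInner (magicPhiComp m h) ∧
        ∃ z ∈ Metric.ball (0 : ℂ) 1, m z * magicPhiComp m h z ≠ -1) →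
      IsSymBidiscInner h) ∧
    (∀ ν n : ℕ, 1 ≤ n → h ∈ EClass ν n →
      (∃ m : ℂ → ℂ, IsBlaschkeLE ν m ∧ IsBlaschkeLE (n - 1) (magicPhiComp m h) ∧
        ∃ z ∈ Metric.ball (0 : ℂ) 1, m z * magicPhiComp m h z ≠ -1) →
      ∃ ds dp : ℕ, HasRationalDegree (fun z => (h z).1) ds ∧
        HasRationalDegree (fun z => (h z).2) dp ∧ ds ≤ 2 * n - 2 ∧ dp ≤ 2 * n - 2) := by
  refine ⟨fun ⟨m, hm, hφ, hne⟩ => isSymBidiscInner_of_isInner_magicPhiComp hh hm hφ hne, ?_⟩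
  rintro ν n hn ⟨-, ⟨ds, hs⟩, ⟨dp, hp⟩, -⟩ ⟨m, hm, hφ, hne⟩
  obtain ⟨h1, h2⟩ := natDegree_le_of_magicPhiComp_blaschke hh hs hp hm hφ hne
  exact ⟨ds, dp, hs, hp, by omega, by omega⟩
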